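/- Let $f:(0,1)\times\mathbb R\to\mathbb R$ be any function, let $\kappa_0,\kappa_1\in\mathbb R$, and consider the Dirichlet problem $$-\left(\frac{u'}{\sqrt{1+(u')^2}}\right)'=f(x,u)\quad (0<x<1),\qquad u(0)=\kappa_0,\quad u(1)=\kappa_1. \tag{1}$$ For $v\in BV(0,1)$ write $Dv=D^av\,dx+D^sv$ for the Lebesgue decomposition of the measure $Dv$, $\frac{D^sv}{|D^sv|}$ for the density of $D^sv$ with respect to its total variation $|D^sv|$, and $v(0^+),v(1^-)$ for the traces of $v$ at $0$ and $1$. A function $u\in BV(0,1)$ is a bounded variation solution of (1) if $f(\cdot,u(\cdot))\in L^1(0,1)$ and $$\int_0^1\frac{D^au\,D^a\phi}{\sqrt{1+(D^au)^2}}\,dx+\int_0^1\frac{D^su}{|D^su|}\,D^s\phi+\operatorname{sgn}(u(0^+)-\kappa_0)\,\phi(0^+)+\operatorname{sgn}(u(1^-)-\kappa_1)\,\phi(1^-)=\int_0^1 f(x,u(x))\,\phi(x)\,dx$$ for all $\phi\in BV(0,1)$ such that $|D^s\phi|$ is absolutely continuous with respect to $|D^su|$, $\phi(0^+)=0$ if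 $u(0^+)=\kappa_0$, and $\phi(1^-)=0$ if $u(1^-)=\kappa_1$. **Theorem 4.2.** Let $u$ be a bounded variation solution of (1). Assume that: (l) there is $z\in(0,1)$ such that $f(x,u(x))\ge 0$ for almost all $x\in(0,z)$ and $f(x,u(x))\le 0$ for almost all $x\in(z,1)$; (ll) there exist $\delta\in(0,1]$ and $\mu_0\in L^1(0,\delta)$ such that $f(x,u(x))\le\mu_0(x)$ for almost all $x\in(0,\delta)$, $M_0(x):=\int_0^x\mu_0(t)\,dt>0$ for all $x\in(0,\delta]$, and $\int_0^\delta\frac{dx}{\sqrt{M_0(x)}}=+\infty$; (lll) there exist $\delta\in(0,1]$ and $\nu_1\in L^1(1-\delta,1)$ such that $f(x,u(x))\ge\nu_1(x)$ for almost all $x\in(1-\delta,1)$, $N_1(x):=\int_x^1\nu_1(t)\,dt<0$ for all $x\in[1-\delta,1)$, and $\int_{1-\delta}^1\frac{dx}{\sqrt{-N_1(x)}}=+\infty$; (llll) either there exist $\delta\in(0,z]$ and $\mu_z\in L^1(z-\delta,z)$ such that $f(x,u(x))\le\mu_z(x)$ for almost all $x\in(z-\delta,z)$, $M_z(x):=\int_x^z\mu_z(t)\,dt>0$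 for all $x\in[z-\delta,z)$, and $\int_{z-\delta}^z\frac{dx}{\sqrt{M_z(x)}}=+\infty$; or there exist $\delta\in(0,1-z]$ and $\nu_z\in L^1(z,z+\delta)$ such that $f(x,u(x))\ge\nu_z(x)$ for almost all $x\in(z,z+\delta)$, $N_z(x):=\int_z^x\nu_z(t)\,dt<0$ for all $x\in(z,z+\delta]$, and $\int_z^{z+\delta}\frac{dx}{\sqrt{-N_z(x)}}=+\infty$. Then $u\in W^{2,1}(0,1)$, and (the continuously differentiable representative of) $u$ satisfies the differential equation in (1) almost everywhere in $(0,1)$ and the boundary conditions $u(0)=\kappa_0$, $u(1)=\kappa_1$. -/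

import Mathlib

open MeasureTheory Set Filter
open scoped Topology ContDiff

/-- Smooth test functions with compact support in the open interval `(a, b)`. -/
def IsTestFunction (a b : ℝ) (φ : ℝ → ℝ) : Prop :=
  ContDiff ℝ ∞ φ ∧ HasCompactSupport φ ∧ tsupport φ ⊆ Ioo a b

/-- `v ∈ BV(a, b)` with distributional derivative the finite signed Borel measure `Dv` on `(a, b)`.
The measure is extended by zero to `ℝ`; functions on `(a, b)` are represented by functions on `ℝ`
whose values outside `(a, b)` play no role. -/
structure HasBVDeriv (a b : ℝ) (v : ℝ → ℝ) (Dv : SignedMeasure ℝ) : Prop where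
  integrableOn : IntegrableOn v (Ioo a b)
  concentrated : Dv.totalVariation (Ioo a b)ᶜ = 0
  integral_deriv : ∀ φ : ℝ → ℝ, IsTestFunction a b φ →
    ∫ x in Ioo a b, v x * deriv φ x = - ∫ᵛ x, φ x ∂•Dv

/-- `Dᵃv`: the Lebesgue density of the absolutely continuous part of `Dv`. -/
noncomputable def acDensity (Dv : SignedMeasure ℝ) : ℝ → ℝ := Dv.rnDeriv volume

/-- `Dˢv`: the singular part of `Dv` with respect to Lebesgue measure. -/
noncomputable def singPart (Dv : SignedMeasure ℝ) : SignedMeasure ℝ := Dv.singularPart volume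

/-- `Dˢv / |Dˢv|`: the density of the singular part with respect to its total variation. -/
noncomputable def singDirection (Dv : SignedMeasure ℝ) : ℝ → ℝ :=
  (singPart Dv).rnDeriv (singPart Dv).totalVariation

/-- `v(x₀⁺) = c`: the right trace, i.e. the essential limit of `v` from the right at `x₀`.
It exists for every function of bounded variation on an interval `(x₀, b)`. -/
def HasRightTrace (v : ℝ → ℝ) (x₀ c : ℝ) : Prop :=
  Tendsto v (𝓝[>] x₀ ⊓ ae volume) (𝓝 c)

/-- `v(x₀⁻) = c`: the left trace, i.e. the essential limit of `v` from the left at `x₀`. -/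
def HasLeftTrace (v : ℝ → ℝ) (x₀ c : ℝ) : Prop :=
  Tendsto v (𝓝[<] x₀ ⊓ ae volume) (𝓝 c)

/-- Bounded variation solutions of the Dirichlet problem
`-(u' / √(1 + u'²))' = f(x, u)` in `(0, 1)`, `u(0) = κ₀`, `u(1) = κ₁`.
`Du`, `u₀ = u(0⁺)` and `u₁ = u(1⁻)` are uniquely determined by `u`, and `Dφ`, `φ₀`, `φ₁` by `φ`. -/
def IsBVSolutionDirichlet (f : ℝ → ℝ → ℝ) (κ₀ κ₁ : ℝ) (u : ℝ → ℝ) : Prop :=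
  IntegrableOn (fun x => f x (u x)) (Ioo 0 1) ∧
  ∃ (Du : SignedMeasure ℝ) (u₀ u₁ : ℝ),
    HasBVDeriv 0 1 u Du ∧ HasRightTrace u 0 u₀ ∧ HasLeftTrace u 1 u₁ ∧
    ∀ (φ : ℝ → ℝ) (Dφ : SignedMeasure ℝ) (φ₀ φ₁ : ℝ),
      HasBVDeriv 0 1 φ Dφ → HasRightTrace φ 0 φ₀ → HasLeftTrace φ 1 φ₁ →
      (singPart Dφ).totalVariation ≪ (singPart Du).totalVariation →
      (u₀ = κ₀ → φ₀ = 0) → (u₁ = κ₁ → φ₁ = 0) →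
      (∫ x in Ioo 0 1, acDensity Du x * acDensity Dφ x / √(1 + acDensity Du x ^ 2))
        + (∫ᵛ x, singDirection Du x ∂•(singPart Dφ))
        + Real.sign (u₀ - κ₀) * φ₀ + Real.sign (u₁ - κ₁) * φ₁
        = ∫ x in Ioo 0 1, f x (u x) * φ x

/-- `w ∈ L¹(a, b)` is the weak derivative of `v ∈ L¹(a, b)`. -/
structure HasWeakDerivOn (a b : ℝ) (v w : ℝ → ℝ) : Prop where
  integrableOn : IntegrableOn v (Ioo a b)
  integrableOn_deriv : IntegrableOn w (Ioo a b)
  integral_deriv : ∀ φ : ℝ → ℝ, IsTestFunction a b φ →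
    ∫ x in Ioo a b, v x * deriv φ x = - ∫ x in Ioo a b, w x * φ x

/-- The Sobolev space `W^{2,1}(a, b)`. -/
def MemW21 (a b : ℝ) (v : ℝ → ℝ) : Prop :=
  ∃ v' v'' : ℝ → ℝ, HasWeakDerivOn a b v v' ∧ HasWeakDerivOn a b v' v''

/-- `u` has a representative `U`, continuous on `[0, 1]` and differentiable in `(0, 1)`, which
satisfies `-(U' / √(1 + U'²))' = f(x, U)` almost everywhere in `(0, 1)`, `U(0) = κ₀`, `U(1) = κ₁`.
(Members of `W^{2,1}(0, 1)` are identified with their continuously differentiable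
representatives.) -/
def SolvesDirichletAE (f : ℝ → ℝ → ℝ) (κ₀ κ₁ : ℝ) (u : ℝ → ℝ) : Prop :=
  ∃ U : ℝ → ℝ, (∀ᵐ x ∂(volume.restrict (Ioo 0 1)), U x = u x) ∧
    ContinuousOn U (Icc 0 1) ∧ DifferentiableOn ℝ U (Ioo 0 1) ∧
    (∀ᵐ x ∂(volume.restrict (Ioo 0 1)),
      HasDerivAt (fun y => deriv U y / √(1 + deriv U y ^ 2)) (-f x (U x)) x) ∧
    U 0 = κ₀ ∧ U 1 = κ₁

/-! Write `a` for the density of the absolutely continuous part of `Du`, `g` for `f(x, u)`, and `a /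
√(1 + a²)` for the flux. Testing with smooth compactly supported functions shows that the flux
equals a.e. a primitive `H` of `-g`, and `|H| ≤ 1` on `[0, 1]`. Everything rests on improving this
to `|H| ≤ m < 1` (`flux_abs_lt_one`).

By the sign condition `H` decreases on `[0, z]` and increases on `[z, 1]`, so only `H 0 = 1`, `H 1 =
1` and `H z = -1` must be excluded. If `H 0 = 1`, then `1 - H ≤ M₀` near `0`, and `|a| = |H| / √(1 -
H²)` is at least a constant times `1 / √M₀`, which is not integrable; but `a` is integrable. The
other two points are alike (`lintegral_one_div_sqrt_lt_top`).

The strict bound has three consequences. An unattained boundary value would force `H = ±1` at that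
endpoint, so the boundary data are attained. Testing with `u` minus an affine function shows that
the total mass of `|Dˢu|` equals `∫ H dDˢu`, which is at most `m` times that mass, so `Dˢu = 0`
(`singPart_totalVariation_eq_zero`). Finally `u' = H / √(1 - H²)` is a Lipschitz function of the
absolutely continuous `H`, which gives `W^{2,1}` regularity and the equation (`regularity_of_flux`).
-/

/-! ### Integration against signed measures and their polar densities. -/

namespace MeasureTheory.SignedMeasure

variable {α : Type*} [MeasurableSpace α]

theorem integral_lsmul_eq_sub (s : SignedMeasure α) {f : α → ℝ}
    (hf : Integrable f s.totalVariation) :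
    ∫ᵛ x, f x ∂•s = ∫ x, f x ∂s.toJordanDecomposition.posPart
      - ∫ x, f x ∂s.toJordanDecomposition.negPart := by
  -- Multiplication on `ℝ` is symmetric; the flipped pairing is the one in
  -- `VectorMeasure.integral_toSignedMeasure`.
  have hflip : (ContinuousLinearMap.lsmul ℝ ℝ : ℝ →L[ℝ] ℝ →L[ℝ] ℝ)
      = (ContinuousLinearMap.lsmul ℝ ℝ : ℝ →L[ℝ] ℝ →L[ℝ] ℝ).flip := by
    ext; simp
  rw [totalVariation, integrable_add_measure] at hf
  conv_lhs => rw [← s.toSignedMeasure_toJordanDecomposition, JordanDecomposition.toSignedMeasure]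
  rw [VectorMeasure.integral_sub_vectorMeasure, hflip, VectorMeasure.integral_toSignedMeasure,
    VectorMeasure.integral_toSignedMeasure]
  · rw [VectorMeasure.Integrable, Measure.variation_toSignedMeasure]; exact hf.1
  · rw [VectorMeasure.Integrable, Measure.variation_toSignedMeasure]; exact hf.2

theorem integral_lsmul_withDensityᵥ {μ : Measure α} {a f : α → ℝ} (ha : Integrable a μ)
    (hf : Measurable f) {C : ℝ} (hC : ∀ x, ‖f x‖ ≤ C) :
    ∫ᵛ x, f x ∂•(μ.withDensityᵥ a) = ∫ x, f x * a x ∂μ := by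
  have hflip : (ContinuousLinearMap.lsmul ℝ ℝ : ℝ →L[ℝ] ℝ →L[ℝ] ℝ)
      = (ContinuousLinearMap.lsmul ℝ ℝ : ℝ →L[ℝ] ℝ →L[ℝ] ℝ).flip := by
    ext; simp
  have h1 := isFiniteMeasure_withDensity_ofReal ha.2
  have h2 := isFiniteMeasure_withDensity_ofReal ha.neg.2
  rw [withDensityᵥ_eq_withDensity_pos_part_sub_withDensity_neg_part ha,
    VectorMeasure.integral_sub_vectorMeasure, hflip, VectorMeasure.integral_toSignedMeasure,
    VectorMeasure.integral_toSignedMeasure]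
  · have e1 : ∀ b : α → ℝ, Integrable b μ →
        ∫ x, f x ∂(μ.withDensity fun x => ENNReal.ofReal (b x)) = ∫ x, max (b x) 0 * f x ∂μ := by
      intro b hb
      rw [integral_withDensity_eq_integral_toReal_smul₀ hb.1.aemeasurable.ennreal_ofReal
        (by simp)]
      simp [ENNReal.toReal_ofReal']
    have e2 : ∀ b : α → ℝ, Integrable b μ → Integrable (fun x => max (b x) 0 * f x) μ := by
      intro b hb
      refine Integrable.mul_bdd (c := C) hb.pos_part hf.aestronglyMeasurable (ae_of_all _ hC)
    rw [e1 _ ha, e1 (fun x => -a x) ha.neg, ← integral_sub (e2 _ ha) (e2 (fun x => -a x) ha.neg)]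
    refine integral_congr_ae (ae_of_all _ fun x => ?_)
    simp only [← sub_mul]
    have := max_zero_sub_max_neg_zero_eq_self (a x)
    simp [this, mul_comm]
  · rw [VectorMeasure.Integrable, Measure.variation_toSignedMeasure]
    exact Integrable.of_bound hf.aestronglyMeasurable C (ae_of_all _ hC)
  · rw [VectorMeasure.Integrable, Measure.variation_toSignedMeasure]
    exact Integrable.of_bound hf.aestronglyMeasurable C (ae_of_all _ hC)

/-- On a Hahn decomposition the polar density is `1` on the positive set and `-1` on the negative
one, so integrating it adds up the masses of both Jordan parts. -/
theorem integral_rnDeriv_totalVariation (s : SignedMeasure α) :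
    ∫ᵛ x, s.rnDeriv s.totalVariation x ∂•s = s.totalVariation.real univ := by
  obtain ⟨S, hS, hp, hn⟩ := s.toJordanDecomposition.mutuallySingular
  set p := s.toJordanDecomposition.posPart with hpdef
  set n := s.toJordanDecomposition.negPart with hndef
  have htv : s.totalVariation = p + n := rfl
  have hpr : p = s.totalVariation.restrict Sᶜ := by
    rw [htv, Measure.restrict_add, Measure.restrict_eq_zero.2 hn, add_zero]
    exact (Measure.restrict_eq_self_of_ae_mem (by
      rw [ae_iff]; simpa using hp)).symm
  have hnr : n = s.totalVariation.restrict S := by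
    rw [htv, Measure.restrict_add, Measure.restrict_eq_zero.2 hp, zero_add]
    exact (Measure.restrict_eq_self_of_ae_mem (by
      rw [ae_iff]; exact hn)).symm
  have h1 : s.rnDeriv s.totalVariation =ᵐ[s.totalVariation]
      fun x => Sᶜ.indicator 1 x - S.indicator 1 x := by
    have a1 : p.rnDeriv s.totalVariation =ᵐ[s.totalVariation] Sᶜ.indicator 1 := by
      conv_lhs => rw [hpr]
      exact Measure.rnDeriv_restrict_self _ hS.compl
    have a2 : n.rnDeriv s.totalVariation =ᵐ[s.totalVariation] S.indicator 1 := by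
      conv_lhs => rw [hnr]
      exact Measure.rnDeriv_restrict_self _ hS
    filter_upwards [a1, a2] with x h1 h2
    rw [rnDeriv_def]
    simp only [← hpdef, ← hndef, h1, h2]
    by_cases hx : x ∈ S <;> simp [hx]
  rw [integral_lsmul_eq_sub s (integrable_rnDeriv _ _)]
  have b1 : ∀ᵐ x ∂p, s.rnDeriv s.totalVariation x = 1 := by
    have c1 : p ≪ s.totalVariation := by rw [htv]; exact Measure.absolutelyContinuous_of_le (Measure.le_add_right le_rfl)
    have c2 : ∀ᵐ x ∂p, x ∉ S := by rw [ae_iff]; simpa using hp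
    filter_upwards [c1.ae_le h1, c2] with x hx hx2
    simp [hx, hx2]
  have b2 : ∀ᵐ x ∂n, s.rnDeriv s.totalVariation x = -1 := by
    have c1 : n ≪ s.totalVariation := by rw [htv]; exact Measure.absolutelyContinuous_of_le (Measure.le_add_left le_rfl)
    have c2 : ∀ᵐ x ∂n, x ∈ S := by rw [ae_iff]; exact hn
    filter_upwards [c1.ae_le h1, c2] with x hx hx2
    simp [hx, hx2]
  rw [integral_congr_ae b1, integral_congr_ae b2, htv]
  simp [measureReal_add_apply]

/-- The equality makes the total mass at most `m` times itself, with `m < 1`. Applied to `Dˢu` with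
the flux as `f`. -/
theorem totalVariation_eq_zero_of_integral_rnDeriv_eq (s : SignedMeasure α) {f : α → ℝ} {m : ℝ}
    (hm : m < 1) (hfm : ∀ᵐ x ∂s.totalVariation, ‖f x‖ ≤ m)
    (h : ∫ᵛ x, s.rnDeriv s.totalVariation x ∂•s = ∫ᵛ x, f x ∂•s) : s.totalVariation = 0 := by
  rw [integral_rnDeriv_totalVariation] at h
  have h1 : ‖∫ᵛ x, f x ∂•s‖ ≤ m * s.totalVariation.real univ := by
    refine VectorMeasure.norm_integral_le_integral_norm.trans ?_
    rw [← totalVariation_eq_variation]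
    have h2 : ∫ x, ‖f x‖ ∂s.totalVariation ≤ m * s.totalVariation.real univ := by
      calc _ ≤ ∫ x, m ∂s.totalVariation :=
            integral_mono_of_nonneg (ae_of_all _ fun x => norm_nonneg _) (integrable_const m) hfm
        _ = _ := by simp [mul_comm]
    have h3 : ‖(ContinuousLinearMap.lsmul ℝ ℝ : ℝ →L[ℝ] ℝ →L[ℝ] ℝ)‖ ≤ 1 :=
      ContinuousLinearMap.opNorm_lsmul_le
    calc _ ≤ 1 * ∫ x, ‖f x‖ ∂s.totalVariation := by gcongr
      _ ≤ _ := by simpa using h2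
  rw [← h, Real.norm_of_nonneg measureReal_nonneg] at h1
  have h0 : 0 ≤ s.totalVariation.real univ := measureReal_nonneg
  have : s.totalVariation.real univ = 0 := by nlinarith
  rwa [measureReal_eq_zero_iff, Measure.measure_univ_eq_zero] at this

end MeasureTheory.SignedMeasure

/-! ### Fubini for cumulative functions. -/

/-- Integration by parts against the cumulative function of a finite measure. -/
theorem integral_mul_measureReal_Iio (μ : Measure ℝ) [IsFiniteMeasure μ] {ν : Measure ℝ} [SFinite ν]
    {w : ℝ → ℝ} (hw : Integrable w ν) :
    ∫ x, w x * μ.real (Iio x) ∂ν = ∫ t, (∫ x in Ioi t, w x ∂ν) ∂μ ∧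
    Integrable (fun x => w x * μ.real (Iio x)) ν ∧
    Integrable (fun t => ∫ x in Ioi t, w x ∂ν) μ := by
  -- Both sides are iterated integrals of `w x` over the half-plane `t < x`.
  have hS : MeasurableSet {p : ℝ × ℝ | p.2 < p.1} := measurableSet_lt measurable_snd measurable_fst
  have hint : Integrable (({p : ℝ × ℝ | p.2 < p.1}).indicator fun p => w p.1) (ν.prod μ) :=
    (hw.comp_fst μ).indicator hS
  have e1 : ∀ x, ∫ t, ({p : ℝ × ℝ | p.2 < p.1}).indicator (fun p => w p.1) (x, t) ∂μ
      = w x * μ.real (Iio x) := by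
    intro x
    have : (fun t => ({p : ℝ × ℝ | p.2 < p.1}).indicator (fun p => w p.1) (x, t))
        = (Iio x).indicator fun _ => w x := by
      ext t; simp [indicator]
    rw [this, integral_indicator measurableSet_Iio]
    simp [mul_comm]
  have e2 : ∀ t, ∫ x, ({p : ℝ × ℝ | p.2 < p.1}).indicator (fun p => w p.1) (x, t) ∂ν
      = ∫ x in Ioi t, w x ∂ν := by
    intro t
    have : (fun x => ({p : ℝ × ℝ | p.2 < p.1}).indicator (fun p => w p.1) (x, t))
        = (Ioi t).indicator w := by
      ext x; simp [indicator]
    rw [this, integral_indicator measurableSet_Ioi]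
  refine ⟨?_, ?_, ?_⟩
  · have := integral_integral_swap (f := fun x t =>
      ({p : ℝ × ℝ | p.2 < p.1}).indicator (fun p => w p.1) (x, t)) hint
    simpa only [e1, e2] using this
  · simpa only [e1] using hint.integral_prod_left
  · simpa only [e2] using hint.integral_prod_right

/-- Serves twice: with `w = φ'` to recover a BV function from its derivative, and with `w = g` to
turn `∫ g u` into an integral of the flux against `Du`. -/
theorem SignedMeasure.integral_mul_apply_Iio (s : SignedMeasure ℝ) {ν : Measure ℝ} [SFinite ν]
    {w : ℝ → ℝ} (hw : Integrable w ν) :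
    ∫ x, w x * s (Iio x) ∂ν = ∫ᵛ t, (∫ x in Ioi t, w x ∂ν) ∂•s ∧
    Integrable (fun x => w x * s (Iio x)) ν := by
  have hp := integral_mul_measureReal_Iio s.toJordanDecomposition.posPart hw
  have hn := integral_mul_measureReal_Iio s.toJordanDecomposition.negPart hw
  have hs : (fun x => w x * s (Iio x)) = fun x =>
      w x * s.toJordanDecomposition.posPart.real (Iio x)
        - w x * s.toJordanDecomposition.negPart.real (Iio x) := by
    ext x
    rw [s.apply_eq_posPart_real_sub_negPart_real measurableSet_Iio, mul_sub]
  rw [hs]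
  refine ⟨?_, hp.2.1.sub hn.2.1⟩
  rw [integral_sub hp.2.1 hn.2.1, hp.1, hn.1, SignedMeasure.integral_lsmul_eq_sub]
  exact integrable_add_measure.2 ⟨hp.2.2, hn.2.2⟩

/-! ### Test functions, integration by parts and the du Bois-Reymond lemma. -/

theorem ContDiff.absolutelyContinuousOnInterval {φ : ℝ → ℝ} (hφ : ContDiff ℝ 1 φ) (a b : ℝ) :
    AbsolutelyContinuousOnInterval φ a b :=
  hφ.contDiffOn.absolutelyContinuousOnInterval

theorem IsTestFunction.contDiff_one {a b : ℝ} {φ : ℝ → ℝ} (h : IsTestFunction a b φ) :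
    ContDiff ℝ 1 φ := h.1.of_le (by exact_mod_cast le_top)

theorem IsTestFunction.eq_zero {a b : ℝ} {φ : ℝ → ℝ} (h : IsTestFunction a b φ) {x : ℝ}
    (hx : x ∉ Ioo a b) : φ x = 0 := by
  by_contra h0
  exact hx (h.2.2 (subset_tsupport _ h0))

/-- A function with absolutely continuous primitive has the expected weak derivative. -/
theorem AbsolutelyContinuousOnInterval.integral_Ioo_mul_deriv {a b : ℝ} (hab : a ≤ b)
    {F w φ : ℝ → ℝ} (hF : AbsolutelyContinuousOnInterval F a b)
    (hw : ∀ᵐ x ∂(volume.restrict (Ioo a b)), HasDerivAt F (w x) x) (hφ : ContDiff ℝ 1 φ) :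
    ∫ x in Ioo a b, F x * deriv φ x = F b * φ b - F a * φ a - ∫ x in Ioo a b, w x * φ x := by
  have h := hF.integral_mul_deriv_eq_deriv_mul (hφ.absolutelyContinuousOnInterval a b)
  rw [intervalIntegral.integral_of_le hab, intervalIntegral.integral_of_le hab,
    integral_Ioc_eq_integral_Ioo, integral_Ioc_eq_integral_Ioo] at h
  rw [h]
  congr 1
  refine integral_congr_ae ?_
  filter_upwards [hw] with x hx
  rw [hx.deriv]

/-- The **du Bois-Reymond lemma**. -/
theorem ae_eq_const_of_integral_mul_deriv_eq_zero {a b : ℝ} (hab : a < b) {v : ℝ → ℝ}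
    (hv : IntegrableOn v (Ioo a b))
    (h : ∀ φ, IsTestFunction a b φ → ∫ x in Ioo a b, v x * deriv φ x = 0) :
    ∃ c, ∀ᵐ x ∂(volume.restrict (Ioo a b)), v x = c := by
  obtain ⟨ρ, hρs, hρc, hρ, hρI⟩ : ∃ ρ : ℝ → ℝ, tsupport ρ ⊆ Ioo a b ∧ HasCompactSupport ρ ∧
      ContDiff ℝ ∞ ρ ∧ ∫ x, ρ x = 1 := by
    let m := (a + b) / 2
    let B : ContDiffBump m := ⟨(b - a) / 8, (b - a) / 4, by linarith, by linarith⟩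
    refine ⟨B.normed volume, ?_, B.hasCompactSupport_normed, B.contDiff_normed,
      B.integral_normed⟩
    rw [B.tsupport_normed_eq, Real.closedBall_eq_Icc]
    intro x hx
    simp only [mem_Icc, B, m] at hx
    constructor <;> linarith [hx.1, hx.2]
  set c := ∫ x in Ioo a b, v x * ρ x with hc
  have hbd : ∀ ψ : ℝ → ℝ, Continuous ψ → HasCompactSupport ψ → IntegrableOn (fun x => v x * ψ x)
      (Ioo a b) := by
    intro ψ hψ hψc
    obtain ⟨C, hC⟩ := hψc.exists_bound_of_continuous hψ
    exact hv.mul_bdd hψ.aestronglyMeasurable (ae_of_all _ hC)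
  refine ⟨c, ?_⟩
  have key := isOpen_Ioo.ae_eq_zero_of_integral_contDiff_smul_eq_zero (U := Ioo a b) (μ := volume)
    (f := fun x => v x - c) ((hv.sub (integrableOn_const (by simp))).locallyIntegrableOn) ?_
  · rw [ae_restrict_iff' measurableSet_Ioo]
    filter_upwards [key] with x hx hxm
    linarith [hx hxm]
  intro φ hφ hφc hφs
  set k := ∫ x, φ x with hk
  -- Subtracting `k * ρ` makes the mean zero, so the primitive of `ψ` is again compactly supported
  -- and may be used as a test function.
  set ψ : ℝ → ℝ := fun x => φ x - k * ρ x with hψ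
  have hψs : ContDiff ℝ ∞ ψ := hφ.sub (contDiff_const.mul hρ)
  have hψI : ∫ x, ψ x = 0 := by
    rw [hψ, integral_sub (hφ.continuous.integrable_of_hasCompactSupport hφc)
      ((hρ.continuous.integrable_of_hasCompactSupport hρc).const_mul k), integral_const_mul, hρI]
    simp [hk]
  obtain ⟨p, q, hap, hpq, hqb, hsupp⟩ : ∃ p q, a < p ∧ p ≤ q ∧ q < b ∧
      ∀ x, x ∉ Icc p q → ψ x = 0 := by
    -- The midpoint makes the compact set visibly nonempty, so its infimum and supremum are attained
    -- inside `(a, b)`.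
    have hK : IsCompact (tsupport φ ∪ tsupport ρ ∪ {(a + b) / 2}) :=
      (hφc.isCompact.union hρc.isCompact).union isCompact_singleton
    have hne : (tsupport φ ∪ tsupport ρ ∪ {(a + b) / 2}).Nonempty := ⟨_, Or.inr rfl⟩
    have hsub : tsupport φ ∪ tsupport ρ ∪ {(a + b) / 2} ⊆ Ioo a b := by
      refine union_subset (union_subset hφs hρs) ?_
      rintro x rfl
      constructor <;> linarith
    refine ⟨sInf _, sSup _, (hsub (hK.sInf_mem hne)).1, ?_, (hsub (hK.sSup_mem hne)).2, ?_⟩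
    · exact csInf_le_csSup hne hK.bddBelow hK.bddAbove
    · intro x hx
      have hx' : x ∉ tsupport φ ∪ tsupport ρ ∪ {(a + b) / 2} := fun h' =>
        hx ⟨csInf_le hK.bddBelow h', le_csSup hK.bddAbove h'⟩
      simp only [mem_union, not_or] at hx'
      simp [hψ, image_eq_zero_of_notMem_tsupport hx'.1.1, image_eq_zero_of_notMem_tsupport hx'.1.2]
  set Ψ : ℝ → ℝ := fun x => ∫ t in p..x, ψ t with hΨ
  have hΨd : ∀ x, HasDerivAt Ψ (ψ x) x := fun x =>
    intervalIntegral.integral_hasDerivAt_right (hψs.continuous.intervalIntegrable _ _)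
      (hψs.continuous.stronglyMeasurableAtFilter _ _) hψs.continuous.continuousAt
  have hΨ' : deriv Ψ = ψ := funext fun x => (hΨd x).deriv
  have hΨs : ContDiff ℝ ∞ Ψ := by
    rw [contDiff_infty_iff_deriv, hΨ']
    exact ⟨fun x => (hΨd x).differentiableAt, hψs⟩
  have hΨ0 : ∀ x, x ∉ Icc p q → Ψ x = 0 := by
    intro x hx
    rcases lt_or_ge x p with hxp | hxp
    · simp only [hΨ]
      rw [intervalIntegral.integral_symm, intervalIntegral.integral_of_le hxp.le,
        integral_Ioc_eq_integral_Ioo, setIntegral_eq_zero_of_forall_eq_zero, neg_zero]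
      intro t ht
      exact hsupp t fun h' => by linarith [h'.1, ht.2]
    · have hxq : q < x := by
        by_contra h'
        exact hx ⟨hxp, not_lt.1 h'⟩
      simp only [hΨ]
      rw [intervalIntegral.integral_of_le hxp, ← integral_Icc_eq_integral_Ioc,
        setIntegral_eq_integral_of_forall_compl_eq_zero, hψI]
      intro t ht
      exact hsupp t fun h' => ht ⟨h'.1, h'.2.trans hxq.le⟩
  have htest : IsTestFunction a b Ψ := by
    have hts : tsupport Ψ ⊆ Icc p q := closure_minimal (fun x hx => by
      by_contra h'
      exact hx (hΨ0 x h')) isClosed_Icc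
    exact ⟨hΨs, HasCompactSupport.of_support_subset_isCompact isCompact_Icc
      ((subset_tsupport _).trans hts), hts.trans fun x hx => ⟨hap.trans_le hx.1, hx.2.trans_lt hqb⟩⟩
  have h0 := h Ψ htest
  rw [hΨ'] at h0
  have hvφ := hbd φ hφ.continuous hφc
  have hvρ := hbd ρ hρ.continuous hρc
  have e1 : ∫ x in Ioo a b, v x * φ x = k * c := by
    have : (fun x => v x * ψ x) = fun x => v x * φ x - k * (v x * ρ x) := by
      ext x; simp only [hψ]; ring
    rw [this, integral_sub hvφ (hvρ.const_mul k), integral_const_mul, ← hc] at h0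
    linarith
  have e2 : ∫ x in Ioo a b, φ x = k := by
    rw [hk]
    refine setIntegral_eq_integral_of_forall_compl_eq_zero fun x hx => ?_
    exact image_eq_zero_of_notMem_tsupport fun h' => hx (hφs h')
  have e3 : ∫ x, φ x • (v x - c) = ∫ x in Ioo a b, φ x • (v x - c) := by
    refine (setIntegral_eq_integral_of_forall_compl_eq_zero fun x hx => ?_).symm
    rw [image_eq_zero_of_notMem_tsupport fun h' => hx (hφs h'), zero_smul]
  have : (fun x => φ x • (v x - c)) = fun x => v x * φ x - c * φ x := by
    ext x; simp only [smul_eq_mul]; ring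
  rw [e3, this, integral_sub hvφ, integral_const_mul, e1, e2]
  · ring
  · exact ((hφ.continuous.integrable_of_hasCompactSupport hφc).const_mul c).integrableOn

theorem integral_Ioi_restrict_Ioo {a b t : ℝ} (ht : t ∈ Ioo a b) (w : ℝ → ℝ) :
    ∫ x in Ioi t, w x ∂(volume.restrict (Ioo a b)) = ∫ x in t..b, w x := by
  rw [Measure.restrict_restrict measurableSet_Ioi, intervalIntegral.integral_of_le ht.2.le,
    integral_Ioc_eq_integral_Ioo]
  congr 2
  ext x
  simp only [mem_inter_iff, mem_Ioi, mem_Ioo]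
  exact ⟨fun h => ⟨h.1, h.2.2⟩, fun h => ⟨h.1, ht.1.trans h.1, h.2⟩⟩

/-- Makes essential one-sided limits, hence traces, unique. -/
theorem neBot_nhdsGT_inf_ae (x : ℝ) : (𝓝[>] x ⊓ ae (volume : Measure ℝ)).NeBot := by
  rw [inf_neBot_iff]
  intro s hs t ht
  obtain ⟨y, hy, hys⟩ := mem_nhdsGT_iff_exists_Ioo_subset.1 hs
  by_contra h
  have hst : Ioo x y ⊆ tᶜ := fun z hz hzt => h ⟨z, hys hz, hzt⟩
  have := measure_mono_null hst ht
  simp only [Real.volume_Ioo, ENNReal.ofReal_eq_zero] at this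
  exact absurd hy (by simp only [mem_Ioi]; linarith)

theorem neBot_nhdsLT_inf_ae (x : ℝ) : (𝓝[<] x ⊓ ae (volume : Measure ℝ)).NeBot := by
  rw [inf_neBot_iff]
  intro s hs t ht
  obtain ⟨y, hy, hys⟩ := mem_nhdsLT_iff_exists_Ioo_subset.1 hs
  by_contra h
  have hst : Ioo y x ⊆ tᶜ := fun z hz hzt => h ⟨z, hys hz, hzt⟩
  have := measure_mono_null hst ht
  simp only [Real.volume_Ioo, ENNReal.ofReal_eq_zero] at this
  exact absurd hy (by simp only [mem_Iio]; linarith)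

theorem SignedMeasure.apply_eq_zero_of_subset {s : SignedMeasure ℝ} {A B : Set ℝ}
    (h : s.totalVariation B = 0) (hAB : A ⊆ B) : s A = 0 := by
  have h1 := s.enorm_le_totalVariation A
  rw [measure_mono_null hAB h] at h1
  simpa using h1

/-- Bounded measurable functions are integrable with respect to a signed measure. -/
theorem SignedMeasure.integrable_of_bound (s : SignedMeasure ℝ) {F : ℝ → ℝ} (hF : Measurable F)
    {C : ℝ} (hC : ∀ x, ‖F x‖ ≤ C) : VectorMeasure.Integrable s F := by
  rw [VectorMeasure.Integrable, ← SignedMeasure.totalVariation_eq_variation]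
  exact Integrable.of_bound hF.aestronglyMeasurable C (ae_of_all _ hC)

/-! ### Functions of bounded variation and their traces. -/

namespace HasBVDeriv

variable {a b : ℝ} {u v : ℝ → ℝ} {Du Dv : SignedMeasure ℝ}

theorem ae_mem (h : HasBVDeriv a b u Du) : ∀ᵐ x ∂Du.totalVariation, x ∈ Ioo a b := by
  rw [ae_iff]
  exact h.concentrated

theorem integral_congr_Ioo (h : HasBVDeriv a b u Du) {F G : ℝ → ℝ} (hFG : EqOn F G (Ioo a b)) :
    ∫ᵛ x, F x ∂•Du = ∫ᵛ x, G x ∂•Du := by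
  refine VectorMeasure.integral_congr_ae ?_
  rw [← SignedMeasure.totalVariation_eq_variation]
  filter_upwards [h.ae_mem] with x hx using hFG hx

/-- A function of bounded variation is, up to a constant, the cumulative function of its
derivative. -/
theorem exists_ae_eq_add_apply_Iio (h : HasBVDeriv a b u Du) (hab : a < b) :
    ∃ c, ∀ᵐ x ∂(volume.restrict (Ioo a b)), u x = c + Du (Iio x) := by
  have hP : IntegrableOn (fun x => Du (Iio x)) (Ioo a b) := by
    have := (SignedMeasure.integral_mul_apply_Iio Du (ν := volume.restrict (Ioo a b))
      (w := fun _ => 1) (integrable_const _)).2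
    simpa [IntegrableOn] using this
  suffices hz : ∀ φ, IsTestFunction a b φ →
      ∫ x in Ioo a b, (u x - Du (Iio x)) * deriv φ x = 0 by
    obtain ⟨c, hc⟩ := ae_eq_const_of_integral_mul_deriv_eq_zero hab
      (v := fun x => u x - Du (Iio x)) (h.integrableOn.sub hP) hz
    refine ⟨c, ?_⟩
    filter_upwards [hc] with x hx
    linarith
  intro φ hφ
  have hφ1 := hφ.contDiff_one
  have hφ' : Continuous (deriv φ) := hφ1.continuous_deriv le_rfl
  obtain ⟨C, hC⟩ := hφ.2.1.deriv.exists_bound_of_continuous hφ'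
  have hw : Integrable (deriv φ) (volume.restrict (Ioo a b)) :=
    Integrable.of_bound hφ'.aestronglyMeasurable C (ae_of_all _ hC)
  have key := SignedMeasure.integral_mul_apply_Iio Du hw
  -- Since `φ b = 0`, the tail integral of `φ'` from `t` to `b` is `-φ t`.
  have e : ∫ᵛ t, (∫ x in Ioi t, deriv φ x ∂(volume.restrict (Ioo a b))) ∂•Du
      = ∫ᵛ t, -φ t ∂•Du := by
    refine h.integral_congr_Ioo fun t ht => ?_
    rw [integral_Ioi_restrict_Ioo ht, intervalIntegral.integral_deriv_eq_sub
      (fun x _ => hφ1.differentiable one_ne_zero x) (hφ'.intervalIntegrable _ _),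
      hφ.eq_zero (fun h => lt_irrefl _ h.2), zero_sub]
  have e2 : (fun x => (u x - Du (Iio x)) * deriv φ x)
      = fun x => u x * deriv φ x - deriv φ x * Du (Iio x) := by
    ext x; ring
  rw [e2, integral_sub (h.integrableOn.mul_bdd hφ'.aestronglyMeasurable (ae_of_all _ hC)) key.2,
    key.1, e, h.integral_deriv φ hφ]
  have := VectorMeasure.integral_fun_neg Du (ContinuousLinearMap.lsmul ℝ ℝ) φ
  rw [this]
  simp

theorem tendsto_apply_Iio_right (h : HasBVDeriv a b u Du) :
    Tendsto (fun x => Du (Iio x)) (𝓝[>] a) (𝓝 0) := by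
  have h1 : Tendsto (fun x => Du.totalVariation (Iio x)) (𝓝[>] a) (𝓝 (Du.totalVariation ∅)) := by
    refine tendsto_measure_of_ae_tendsto_indicator_of_isFiniteMeasure _ MeasurableSet.empty
      (fun _ => measurableSet_Iio) ?_
    filter_upwards [h.ae_mem] with t ht
    filter_upwards [nhdsWithin_le_nhds (Iio_mem_nhds ht.1)] with x hx
    have hx' : ¬ t < x := not_lt.2 (le_of_lt (mem_Iio.1 hx))
    simpa using hx'
  rw [measure_empty] at h1
  rw [tendsto_zero_iff_enorm_tendsto_zero]
  exact tendsto_of_tendsto_of_tendsto_of_le_of_le tendsto_const_nhds h1 (fun _ => zero_le)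
    (fun x => Du.enorm_le_totalVariation _)

theorem tendsto_apply_Iio_left (h : HasBVDeriv a b u Du) :
    Tendsto (fun x => Du (Iio x)) (𝓝[<] b) (𝓝 (Du univ)) := by
  have h1 : Tendsto (fun x => Du.totalVariation (Ici x)) (𝓝[<] b) (𝓝 (Du.totalVariation ∅)) := by
    refine tendsto_measure_of_ae_tendsto_indicator_of_isFiniteMeasure _ MeasurableSet.empty
      (fun _ => measurableSet_Ici) ?_
    filter_upwards [h.ae_mem] with t ht
    filter_upwards [nhdsWithin_le_nhds (Ioi_mem_nhds ht.2)] with x hx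
    simpa using hx
  rw [measure_empty] at h1
  have h2 : Tendsto (fun x => Du (Ici x)) (𝓝[<] b) (𝓝 0) := by
    rw [tendsto_zero_iff_enorm_tendsto_zero]
    exact tendsto_of_tendsto_of_tendsto_of_le_of_le tendsto_const_nhds h1 (fun _ => zero_le)
      (fun x => Du.enorm_le_totalVariation _)
  have h3 : (fun x => Du (Iio x)) = fun x => Du univ - Du (Ici x) := by
    ext x
    have := Du.of_union (A := Iio x) (B := Ici x)
      (by rw [← compl_Iio]; exact disjoint_compl_right) measurableSet_Iio measurableSet_Ici
    rw [Iio_union_Ici] at this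
    linarith
  rw [h3]
  simpa using (tendsto_const_nhds (x := Du univ)).sub h2

/-- As `Du` lives on the open interval, `Du (Iio x)` tends to `0` at `a` and to `Du univ` at `b`;
uniqueness of traces then identifies the additive constant. -/
theorem ae_eq_add_apply_Iio (h : HasBVDeriv a b u Du) (hab : a < b) {u₀ u₁ : ℝ}
    (h0 : HasRightTrace u a u₀) (h1 : HasLeftTrace u b u₁) :
    (∀ᵐ x ∂(volume.restrict (Ioo a b)), u x = u₀ + Du (Iio x)) ∧ u₁ = u₀ + Du univ := by
  obtain ⟨c, hc⟩ := h.exists_ae_eq_add_apply_Iio hab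
  have hc' := (ae_restrict_iff' measurableSet_Ioo).1 hc
  have hc0 : c = u₀ := by
    have := neBot_nhdsGT_inf_ae a
    refine tendsto_nhds_unique (f := u) (l := 𝓝[>] a ⊓ ae volume) ?_ h0
    have t := (tendsto_const_nhds (x := c)).add
      (h.tendsto_apply_Iio_right.mono_left (inf_le_left (b := ae volume)))
    rw [add_zero] at t
    refine t.congr' ?_
    filter_upwards [mem_inf_of_left (Ioo_mem_nhdsGT hab), mem_inf_of_right hc'] with x hx hx'
    exact (hx' hx).symm
  have hc1 : c + Du univ = u₁ := by
    have := neBot_nhdsLT_inf_ae b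
    refine tendsto_nhds_unique (f := u) (l := 𝓝[<] b ⊓ ae volume) ?_ h1
    have t := (tendsto_const_nhds (x := c)).add
      (h.tendsto_apply_Iio_left.mono_left (inf_le_left (b := ae volume)))
    refine t.congr' ?_
    filter_upwards [mem_inf_of_left (Ioo_mem_nhdsLT hab), mem_inf_of_right hc'] with x hx hx'
    exact (hx' hx).symm
  subst hc0
  exact ⟨hc, hc1.symm⟩

theorem sub (hu : HasBVDeriv a b u Du) (hv : HasBVDeriv a b v Dv) :
    HasBVDeriv a b (fun x => u x - v x) (Du - Dv) := by
  refine ⟨hu.integrableOn.sub hv.integrableOn, ?_, fun φ hφ => ?_⟩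
  · rw [SignedMeasure.totalVariation_eq_variation]
    have h1 : (Du - Dv).variation ≤ Du.variation + Dv.variation := by
      rw [sub_eq_add_neg]
      refine VectorMeasure.variation_add_le.trans ?_
      rw [VectorMeasure.variation_neg]
    have h2 := h1 (Ioo a b)ᶜ
    rw [Measure.add_apply, ← SignedMeasure.totalVariation_eq_variation Du,
      ← SignedMeasure.totalVariation_eq_variation Dv, hu.concentrated, hv.concentrated] at h2
    simpa using h2
  · have hφ1 := hφ.contDiff_one
    have hφ' : Continuous (deriv φ) := hφ1.continuous_deriv le_rfl
    obtain ⟨C, hC⟩ := hφ.2.1.deriv.exists_bound_of_continuous hφ'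
    obtain ⟨C', hC'⟩ := hφ.2.1.exists_bound_of_continuous hφ1.continuous
    simp only [sub_mul]
    rw [integral_sub (hu.integrableOn.mul_bdd hφ'.aestronglyMeasurable (ae_of_all _ hC))
      (hv.integrableOn.mul_bdd hφ'.aestronglyMeasurable (ae_of_all _ hC)),
      hu.integral_deriv φ hφ, hv.integral_deriv φ hφ, VectorMeasure.integral_sub_vectorMeasure
      (SignedMeasure.integrable_of_bound Du hφ1.continuous.measurable hC')
      (SignedMeasure.integrable_of_bound Dv hφ1.continuous.measurable hC')]
    ring

end HasBVDeriv

/-! ### Smooth functions as BV functions. -/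

section Smooth

variable {a b : ℝ} {φ : ℝ → ℝ}

theorem ContDiff.integrable_indicator_deriv (hφ : ContDiff ℝ 1 φ) :
    Integrable ((Ioo a b).indicator (deriv φ)) := by
  rw [integrable_indicator_iff measurableSet_Ioo]
  exact ((hφ.continuous_deriv le_rfl).integrableOn_Icc (a := a) (b := b)).mono_set Ioo_subset_Icc_self

theorem ContDiff.hasBVDeriv (hφ : ContDiff ℝ 1 φ) (hab : a ≤ b) :
    HasBVDeriv a b φ (volume.withDensityᵥ ((Ioo a b).indicator (deriv φ))) := by
  have hi := hφ.integrable_indicator_deriv (a := a) (b := b)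
  refine ⟨(hφ.continuous.integrableOn_Icc (a := a) (b := b)).mono_set Ioo_subset_Icc_self, ?_, ?_⟩
  · rw [SignedMeasure.totalVariation_eq_variation, Measure.variation_withDensityᵥ hi,
      withDensity_apply _ measurableSet_Ioo.compl]
    refine (setLIntegral_congr_fun measurableSet_Ioo.compl (g := fun _ => 0) fun x hx => ?_).trans
      (by simp)
    simp [indicator_of_notMem hx]
  · intro ψ hψ
    have hψ1 := hψ.contDiff_one
    obtain ⟨C, hC⟩ := hψ.2.1.exists_bound_of_continuous hψ1.continuous
    rw [SignedMeasure.integral_lsmul_withDensityᵥ hi hψ1.continuous.measurable hC]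
    rw [(hφ.absolutelyContinuousOnInterval a b).integral_Ioo_mul_deriv hab (w := deriv φ)
      (ae_of_all _ fun x => (hφ.differentiable one_ne_zero x).hasDerivAt) hψ1,
      hψ.eq_zero (fun h => lt_irrefl _ h.1), hψ.eq_zero (fun h => lt_irrefl _ h.2),
      ← integral_indicator measurableSet_Ioo]
    simp only [mul_zero, sub_self, zero_sub, neg_inj]
    congr 1
    ext x
    by_cases hx : x ∈ Ioo a b <;> simp [hx, mul_comm]

theorem singPart_withDensityᵥ {w : ℝ → ℝ} :
    singPart (volume.withDensityᵥ w) = 0 :=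
  SignedMeasure.eq_singularPart 0 w VectorMeasure.MutuallySingular.zero_left (zero_add _).symm |>.symm

theorem acDensity_withDensityᵥ {w : ℝ → ℝ} (hw : Integrable w) :
    acDensity (volume.withDensityᵥ w) =ᵐ[volume] w :=
  (SignedMeasure.eq_rnDeriv 0 w hw VectorMeasure.MutuallySingular.zero_left (zero_add _).symm).symm

theorem Continuous.hasRightTrace (hφ : Continuous φ) (x : ℝ) : HasRightTrace φ x (φ x) :=
  hφ.continuousAt.mono_left (inf_le_left.trans nhdsWithin_le_nhds)

theorem Continuous.hasLeftTrace (hφ : Continuous φ) (x : ℝ) : HasLeftTrace φ x (φ x) :=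
  hφ.continuousAt.mono_left (inf_le_left.trans nhdsWithin_le_nhds)

end Smooth

/-! ### Nonintegrability and the strict flux bound. -/

/-- If `k` attains the value `1` at `e`, `1 - k ≤ M` and `|a| = |k| / √(1 - k²)` is integrable,
then so is `1 / √M`. -/
theorem lintegral_one_div_sqrt_lt_top {p q e : ℝ} {k M a : ℝ → ℝ}
    (hk : ContinuousOn k (Icc p q)) (hM : ContinuousOn M (Icc p q)) (hke : k e = 1)
    (hMpos : ∀ x ∈ Icc p q, x ≠ e → 0 < M x) (ha : IntegrableOn a (Ioo p q))
    (hka : ∀ᵐ x ∂(volume.restrict (Ioo p q)), |k x| < 1 ∧ |a x| = |k x| / √(1 - k x ^ 2))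
    (hkM : ∀ᵐ x ∂(volume.restrict (Ioo p q)), 1 - k x ≤ M x) :
    ∫⁻ x in Ioo p q, ENNReal.ofReal (1 / √(M x)) < ⊤ := by
  -- The set where `k ≤ 1/2` is compact and misses `e`, so `M` has a positive minimum there.
  obtain ⟨m, hm, hmM⟩ : ∃ m, 0 < m ∧ ∀ x ∈ Icc p q, k x ≤ 1 / 2 → m ≤ M x := by
    have hK : IsCompact (Icc p q ∩ k ⁻¹' Iic (1 / 2)) :=
      isCompact_Icc.of_isClosed_subset (hk.preimage_isClosed_of_isClosed isClosed_Icc isClosed_Iic)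
        inter_subset_left
    rcases (Icc p q ∩ k ⁻¹' Iic (1 / 2)).eq_empty_or_nonempty with h | h
    · refine ⟨1, one_pos, fun x hx hx2 => ?_⟩
      have : x ∈ (∅ : Set ℝ) := h ▸ ⟨hx, hx2⟩
      exact this.elim
    · obtain ⟨x₀, hx₀, hmin⟩ := hK.exists_isMinOn h (hM.mono inter_subset_left)
      refine ⟨M x₀, hMpos x₀ hx₀.1 ?_, fun x hx hx2 => hmin ⟨hx, hx2⟩⟩
      rintro rfl
      have := hx₀.2
      simp only [mem_preimage, hke, mem_Iic] at this
      norm_num at this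
  have hint : IntegrableOn (fun x => 4 * |a x| + 1 / √m) (Ioo p q) :=
    (ha.abs.const_mul 4).add (integrableOn_const (by simp))
  refine lt_of_le_of_lt (lintegral_mono_ae ?_) hint.lintegral_lt_top
  filter_upwards [hka, hkM, ae_restrict_mem measurableSet_Ioo] with x hx hxM hxm
  refine ENNReal.ofReal_le_ofReal ?_
  have hsm : 0 < √m := Real.sqrt_pos.2 hm
  have hx1 := abs_lt.1 hx.1
  rcases le_or_gt (k x) (1 / 2) with h | h
  · have h1 := hmM x (Ioo_subset_Icc_self hxm) h
    calc 1 / √(M x) ≤ 1 / √m := one_div_le_one_div_of_le hsm (Real.sqrt_le_sqrt h1)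
      _ ≤ _ := by linarith [abs_nonneg (a x)]
  · have hMx : 0 < M x := by linarith
    have hs : 0 < √(M x) := Real.sqrt_pos.2 hMx
    -- `1 - k² = (1 - k)(1 + k) ≤ 2M`; together with `k > 1/2` this yields the factor `4` below.
    have h1 : √(1 - k x ^ 2) ≤ 2 * √(M x) := by
      rw [Real.sqrt_le_left (by positivity), mul_pow, Real.sq_sqrt hMx.le]
      nlinarith
    have h2 : 0 < √(1 - k x ^ 2) := Real.sqrt_pos.2 (by nlinarith)
    have h3 : 1 / √(M x) ≤ 4 * |a x| := by
      rw [hx.2, abs_of_pos (by linarith : 0 < k x), ← mul_div_assoc, div_le_div_iff₀ hs h2]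
      nlinarith
    have : 0 < 1 / √m := by positivity
    linarith

/-- With `s = a / √(1 + a²)` one has `1 - s² = 1 / (1 + a²)`, so the slope is recovered from the
flux as `s / √(1 - s²)`. -/
theorem div_sqrt_one_add_sq_bound (a : ℝ) :
    |a / √(1 + a ^ 2)| < 1 ∧
    a = (a / √(1 + a ^ 2)) / √(1 - (a / √(1 + a ^ 2)) ^ 2) := by
  have h0 : 0 < 1 + a ^ 2 := by positivity
  have hs : 0 < √(1 + a ^ 2) := Real.sqrt_pos.2 h0
  have h1 : 1 - (a / √(1 + a ^ 2)) ^ 2 = (√(1 + a ^ 2))⁻¹ ^ 2 := by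
    rw [div_pow, inv_pow, Real.sq_sqrt h0.le]
    field_simp
    ring
  constructor
  · rw [abs_div, abs_of_pos hs, div_lt_one hs]
    refine Real.lt_sqrt_of_sq_lt ?_
    rw [sq_abs]
    linarith
  · rw [h1, Real.sqrt_sq (by positivity)]
    field_simp

theorem div_sqrt_one_sub_sq_inverse {s : ℝ} (hs : |s| < 1) :
    (s / √(1 - s ^ 2)) / √(1 + (s / √(1 - s ^ 2)) ^ 2) = s := by
  have h0 : 0 < 1 - s ^ 2 := by nlinarith [abs_lt.1 hs]
  have hp : 0 < √(1 - s ^ 2) := Real.sqrt_pos.2 h0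
  have h1 : 1 + (s / √(1 - s ^ 2)) ^ 2 = (√(1 - s ^ 2))⁻¹ ^ 2 := by
    rw [div_pow, inv_pow, Real.sq_sqrt h0.le]
    field_simp
    ring
  rw [h1, Real.sqrt_sq (by positivity)]
  field_simp

theorem hasDerivAt_div_sqrt_one_sub_sq {s : ℝ} (hs : |s| < 1) :
    HasDerivAt (fun s : ℝ => s / √(1 - s ^ 2)) (1 / ((1 - s ^ 2) * √(1 - s ^ 2))) s := by
  have h0 : 0 < 1 - s ^ 2 := by nlinarith [abs_lt.1 hs]
  have hp : 0 < √(1 - s ^ 2) := Real.sqrt_pos.2 h0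
  have h1 : HasDerivAt (fun s : ℝ => 1 - s ^ 2) (-(2 * s)) s := by
    simpa using (hasDerivAt_pow 2 s).const_sub 1
  refine ((hasDerivAt_id s).div (h1.sqrt h0.ne') hp.ne').congr_deriv ?_
  have h2 : √(1 - s ^ 2) ^ 2 = 1 - s ^ 2 := Real.sq_sqrt h0.le
  simp only [id]
  rw [h2]
  field_simp
  rw [h2]
  ring

theorem AbsolutelyContinuousOnInterval.lipschitzOnWith_comp {K : NNReal} {G H : ℝ → ℝ} {S : Set ℝ}
    {a b : ℝ} (hG : LipschitzOnWith K G S) (hH : AbsolutelyContinuousOnInterval H a b)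
    (hS : MapsTo H (uIcc a b) S) : AbsolutelyContinuousOnInterval (fun x => G (H x)) a b := by
  rw [absolutelyContinuousOnInterval_iff] at hH ⊢
  intro ε hε
  -- `K + 1` avoids division by zero when `K = 0`.
  have hK : (0 : ℝ) < K + 1 := by positivity
  obtain ⟨δ, hδ, h⟩ := hH (ε / (K + 1)) (by positivity)
  refine ⟨δ, hδ, fun E hE hEδ => ?_⟩
  have h1 := h E hE hEδ
  rw [lt_div_iff₀ hK, mul_comm, Finset.mul_sum] at h1
  refine lt_of_le_of_lt (Finset.sum_le_sum fun i hi => ?_) h1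
  have hi' := hE.1 i hi
  calc dist (G (H (E.2 i).1)) (G (H (E.2 i).2)) ≤ K * dist (H (E.2 i).1) (H (E.2 i).2) :=
        hG.dist_le_mul _ (hS hi'.1) _ (hS hi'.2)
    _ ≤ _ := by gcongr; linarith

/-- A continuous function which is a.e. at most `1` on an interval is at most `1` on its closure. -/
theorem le_one_of_ae_le_one {a b : ℝ} (hab : a < b) {k : ℝ → ℝ} (hk : Continuous k)
    (h : ∀ᵐ x ∂(volume.restrict (Ioo a b)), k x ≤ 1) : ∀ x ∈ Icc a b, k x ≤ 1 := by
  have h1 : (fun x => min (k x) 1) =ᵐ[volume.restrict (Icc a b)] k := by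
    rw [← restrict_Ioo_eq_restrict_Icc]
    filter_upwards [h] with x hx using min_eq_left hx
  have h2 := Measure.eqOn_Icc_of_ae_eq volume hab.ne h1 (by fun_prop) hk.continuousOn
  exact fun x hx => min_eq_left_iff.1 (h2 hx)

/-- The flux `u' / √(1 + u'²)` of a solution, as a primitive of `-f(x, u)`, is bounded away from
`±1` under the growth conditions of the theorem. -/
theorem flux_abs_lt_one {g a H : ℝ → ℝ} {C z : ℝ} (hz : z ∈ Ioo (0 : ℝ) 1)
    (hg : Integrable g) (hH : ∀ x, H x = C - ∫ t in (0 : ℝ)..x, g t)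
    (ha : IntegrableOn a (Ioo 0 1))
    (haH : ∀ᵐ x ∂(volume.restrict (Ioo 0 1)), a x / √(1 + a x ^ 2) = H x)
    (hpos : ∀ᵐ x ∂(volume.restrict (Ioo 0 z)), 0 ≤ g x)
    (hneg : ∀ᵐ x ∂(volume.restrict (Ioo z 1)), g x ≤ 0)
    (h0 : ∃ δ : ℝ, 0 < δ ∧ δ ≤ 1 ∧ ∃ μ₀ : ℝ → ℝ, IntegrableOn μ₀ (Ioo 0 δ) ∧
      (∀ᵐ x ∂(volume.restrict (Ioo 0 δ)), g x ≤ μ₀ x) ∧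
      (∀ x ∈ Ioc 0 δ, 0 < ∫ t in (0 : ℝ)..x, μ₀ t) ∧
      ∫⁻ x in Ioo 0 δ, ENNReal.ofReal (1 / √(∫ t in (0 : ℝ)..x, μ₀ t)) = ⊤)
    (h1 : ∃ δ : ℝ, 0 < δ ∧ δ ≤ 1 ∧ ∃ ν₁ : ℝ → ℝ, IntegrableOn ν₁ (Ioo (1 - δ) 1) ∧
      (∀ᵐ x ∂(volume.restrict (Ioo (1 - δ) 1)), ν₁ x ≤ g x) ∧
      (∀ x ∈ Ico (1 - δ) 1, ∫ t in x..1, ν₁ t < 0) ∧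
      ∫⁻ x in Ioo (1 - δ) 1, ENNReal.ofReal (1 / √(-∫ t in x..1, ν₁ t)) = ⊤)
    (hcz : (∃ δ : ℝ, 0 < δ ∧ δ ≤ z ∧ ∃ μz : ℝ → ℝ, IntegrableOn μz (Ioo (z - δ) z) ∧
        (∀ᵐ x ∂(volume.restrict (Ioo (z - δ) z)), g x ≤ μz x) ∧
        (∀ x ∈ Ico (z - δ) z, 0 < ∫ t in x..z, μz t) ∧
        ∫⁻ x in Ioo (z - δ) z, ENNReal.ofReal (1 / √(∫ t in x..z, μz t)) = ⊤) ∨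
      (∃ δ : ℝ, 0 < δ ∧ δ ≤ 1 - z ∧ ∃ νz : ℝ → ℝ, IntegrableOn νz (Ioo z (z + δ)) ∧
        (∀ᵐ x ∂(volume.restrict (Ioo z (z + δ))), νz x ≤ g x) ∧
        (∀ x ∈ Ioc z (z + δ), ∫ t in z..x, νz t < 0) ∧
        ∫⁻ x in Ioo z (z + δ), ENNReal.ofReal (1 / √(-∫ t in z..x, νz t)) = ⊤)) :
    ∃ m < 1, ∀ x ∈ Icc (0 : ℝ) 1, |H x| ≤ m := by
  have hHc : Continuous H := by
    have : H = fun x => C - ∫ t in (0 : ℝ)..x, g t := funext hH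
    rw [this]
    exact continuous_const.sub (intervalIntegral.continuous_primitive
      (fun _ _ => hg.intervalIntegrable) 0)
  have hsub : ∀ x y, H x - H y = ∫ t in x..y, g t := by
    intro x y
    have := intervalIntegral.integral_interval_sub_left (μ := volume) (f := g) (a := 0) (b := y)
      (c := x) hg.intervalIntegrable hg.intervalIntegrable
    rw [hH, hH, ← this]
    ring
  have hka : ∀ᵐ x ∂(volume.restrict (Ioo 0 1)), |H x| < 1 ∧ |a x| = |H x| / √(1 - H x ^ 2) := by
    filter_upwards [haH] with x hx
    have := div_sqrt_one_add_sq_bound (a x)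
    rw [hx] at this
    refine ⟨this.1, ?_⟩
    conv_lhs => rw [this.2]
    rw [abs_div, abs_of_nonneg (Real.sqrt_nonneg _)]
  have hka' : ∀ p q, 0 ≤ p → q ≤ 1 → ∀ᵐ x ∂(volume.restrict (Ioo p q)),
      |H x| < 1 ∧ |a x| = |H x| / √(1 - H x ^ 2) := fun p q hp hq =>
    ae_restrict_of_ae_restrict_of_subset (Ioo_subset_Ioo hp hq) hka
  have hle : ∀ x ∈ Icc (0 : ℝ) 1, |H x| ≤ 1 :=
    le_one_of_ae_le_one zero_lt_one hHc.abs (hka.mono fun x hx => hx.1.le)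
  -- comparison of primitives
  have mono : ∀ {p q x y : ℝ} {w₁ w₂ : ℝ → ℝ}, p ≤ x → x ≤ y → y ≤ q →
      IntegrableOn w₁ (Ioo p q) → IntegrableOn w₂ (Ioo p q) →
      (∀ᵐ t ∂(volume.restrict (Ioo p q)), w₁ t ≤ w₂ t) →
      ∫ t in x..y, w₁ t ≤ ∫ t in x..y, w₂ t := by
    intro p q x y w₁ w₂ hpx hxy hyq h₁ h₂ h
    rw [intervalIntegral.integral_of_le hxy, intervalIntegral.integral_of_le hxy,
      integral_Ioc_eq_integral_Ioo, integral_Ioc_eq_integral_Ioo]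
    have hs : Ioo x y ⊆ Ioo p q := Ioo_subset_Ioo hpx hyq
    exact integral_mono_ae (h₁.mono_set hs) (h₂.mono_set hs)
      (ae_restrict_of_ae_restrict_of_subset hs h)
  have contL : ∀ {p q : ℝ} {w : ℝ → ℝ}, p ≤ q → IntegrableOn w (Ioo p q) →
      ContinuousOn (fun x => ∫ t in p..x, w t) (Icc p q) := by
    intro p q w hpq hw
    have := intervalIntegral.continuousOn_primitive_interval (f := w) (a := p) (b := q)
      (μ := volume) (by rwa [uIcc_of_le hpq, integrableOn_Icc_iff_integrableOn_Ioo])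
    rwa [uIcc_of_le hpq] at this
  have contR : ∀ {p q : ℝ} {w : ℝ → ℝ}, p ≤ q → IntegrableOn w (Ioo p q) →
      ContinuousOn (fun x => ∫ t in x..q, w t) (Icc p q) := by
    intro p q w hpq hw
    have := intervalIntegral.continuousOn_primitive_interval_left (f := w) (a := p) (b := q)
      (μ := volume) (by rwa [uIcc_of_le hpq, integrableOn_Icc_iff_integrableOn_Ioo])
    rwa [uIcc_of_le hpq] at this
  -- If `H 0 = 1`, then `1 - H x = ∫ g` over `(0, x)`, which is at most the primitive of `μ`.
  have H0 : H 0 ≠ 1 := by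
    intro hH0
    obtain ⟨δ, hδ, hδ1, μ, hμ, hgμ, hpos', htop⟩ := h0
    refine (lintegral_one_div_sqrt_lt_top (k := H) (e := 0) hHc.continuousOn (contL hδ.le hμ) hH0
      (fun x hx hx0 => hpos' x ⟨lt_of_le_of_ne hx.1 (Ne.symm hx0), hx.2⟩)
      (ha.mono_set (Ioo_subset_Ioo le_rfl hδ1)) (hka' _ _ le_rfl hδ1) ?_).ne htop
    filter_upwards [ae_restrict_mem measurableSet_Ioo] with x hx
    rw [← hH0, hsub]
    exact mono le_rfl hx.1.le hx.2.le hg.integrableOn hμ hgμ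
  have H1 : H 1 ≠ 1 := by
    intro hH1
    obtain ⟨δ, hδ, hδ1, ν, hν, hgν, hneg', htop⟩ := h1
    refine (lintegral_one_div_sqrt_lt_top (k := H) (e := 1) hHc.continuousOn
      (contR (by linarith) hν).neg hH1
      (fun x hx hx0 => neg_pos.2 (hneg' x ⟨hx.1, lt_of_le_of_ne hx.2 hx0⟩))
      (ha.mono_set (Ioo_subset_Ioo (by linarith) le_rfl)) (hka' _ _ (by linarith) le_rfl) ?_).ne htop
    filter_upwards [ae_restrict_mem measurableSet_Ioo] with x hx
    have := hsub x 1
    rw [hH1] at this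
    have h2 := mono hx.1.le hx.2.le le_rfl hν hg.integrableOn hgν
    simp only [Pi.neg_apply]
    linarith
  -- The same argument for `-H` at `z`; nonintegrability on one side of `z` is enough.
  have Hz : H z ≠ -1 := by
    intro hHz
    have hnka : ∀ p q, 0 ≤ p → q ≤ 1 → ∀ᵐ x ∂(volume.restrict (Ioo p q)),
        |-H x| < 1 ∧ |a x| = |-H x| / √(1 - (-H x) ^ 2) := fun p q hp hq => by
      simpa only [abs_neg, neg_sq] using hka' p q hp hq
    rcases hcz with ⟨δ, hδ, hδz, μ, hμ, hgμ, hpos', htop⟩ | ⟨δ, hδ, hδz, ν, hν, hgν, hneg', htop⟩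
    · refine (lintegral_one_div_sqrt_lt_top (k := fun x => -H x) (e := z) hHc.neg.continuousOn
        (contR (by linarith) hμ) (by simp [hHz])
        (fun x hx hx0 => hpos' x ⟨hx.1, lt_of_le_of_ne hx.2 hx0⟩)
        (ha.mono_set (Ioo_subset_Ioo (by linarith) hz.2.le))
        (hnka _ _ (by linarith) hz.2.le) ?_).ne htop
      filter_upwards [ae_restrict_mem measurableSet_Ioo] with x hx
      have := hsub x z
      rw [hHz] at this
      have h2 := mono hx.1.le hx.2.le le_rfl hg.integrableOn hμ hgμ
      linarith
    · refine (lintegral_one_div_sqrt_lt_top (k := fun x => -H x) (e := z) hHc.neg.continuousOn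
        (contL (by linarith) hν).neg (by simp [hHz])
        (fun x hx hx0 => neg_pos.2 (hneg' x ⟨lt_of_le_of_ne hx.1 (Ne.symm hx0), hx.2⟩))
        (ha.mono_set (Ioo_subset_Ioo hz.1.le (by linarith)))
        (hnka _ _ hz.1.le (by linarith)) ?_).ne htop
      filter_upwards [ae_restrict_mem measurableSet_Ioo] with x hx
      have := hsub z x
      rw [hHz] at this
      have h2 := mono le_rfl hx.1.le hx.2.le hν hg.integrableOn hgν
      simp only [Pi.neg_apply]
      linarith
  have b0 := lt_of_le_of_ne (abs_le.1 (hle 0 (by simp))).2 H0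
  have b1 := lt_of_le_of_ne (abs_le.1 (hle 1 (by simp))).2 H1
  have bz := lt_of_le_of_ne (abs_le.1 (hle z (Ioo_subset_Icc_self hz))).1 (Ne.symm Hz)
  refine ⟨max (max (H 0) (H 1)) (-H z), by simp only [max_lt_iff]; exact ⟨⟨b0, b1⟩, by linarith⟩,
    fun x hx => ?_⟩
  have hzero : ∀ p q : ℝ, IntegrableOn (fun _ : ℝ => (0 : ℝ)) (Ioo p q) := fun p q =>
    integrableOn_zero
  -- `H` decreases up to `z` and increases after it, so its extreme values on `[0, 1]` are among
  -- those at `0`, `z` and `1`.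
  have key : H z ≤ H x ∧ H x ≤ max (H 0) (H 1) := by
    rcases le_total x z with hxz | hxz
    · have e1 := mono hx.1 hxz le_rfl (hzero _ _) hg.integrableOn hpos
      have e2 := mono le_rfl hx.1 hxz (hzero _ _) hg.integrableOn hpos
      rw [← hsub] at e1 e2
      simp only [intervalIntegral.integral_zero] at e1 e2
      exact ⟨by linarith, le_max_of_le_left (by linarith)⟩
    · have e1 := mono le_rfl hxz hx.2 hg.integrableOn (hzero _ _) hneg
      have e2 := mono hxz hx.2 le_rfl hg.integrableOn (hzero _ _) hneg
      rw [← hsub] at e1 e2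
      simp only [intervalIntegral.integral_zero] at e1 e2
      exact ⟨by linarith, le_max_of_le_right (by linarith)⟩
  rw [abs_le]
  exact ⟨by linarith [key.1, le_max_right (max (H 0) (H 1)) (-H z)],
    key.2.trans (le_max_left _ _)⟩

/-! ### Lebesgue decomposition and the weak form for smooth test functions. -/

theorem acDensity_sub_withDensityᵥ (Du : SignedMeasure ℝ) {w : ℝ → ℝ} (hw : Integrable w) :
    acDensity (Du - volume.withDensityᵥ w) =ᵐ[volume] fun x => acDensity Du x - w x := by
  have h := SignedMeasure.rnDeriv_sub Du (volume.withDensityᵥ w) volume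
  filter_upwards [h, acDensity_withDensityᵥ hw] with x h1 h2
  rw [← h2]
  exact h1

/-- Makes `u` minus a smooth function satisfy the absolute continuity requirement on test functions.
-/
theorem singPart_sub_withDensityᵥ (Du : SignedMeasure ℝ) {w : ℝ → ℝ} :
    singPart (Du - volume.withDensityᵥ w) = singPart Du := by
  have h := SignedMeasure.singularPart_sub Du (volume.withDensityᵥ w) volume
  have h2 : SignedMeasure.singularPart (volume.withDensityᵥ w) volume = 0 := singPart_withDensityᵥ
  rw [h2, sub_zero] at h
  exact h

theorem singPart_add_withDensityᵥ_acDensity (Du : SignedMeasure ℝ) :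
    singPart Du + volume.withDensityᵥ (acDensity Du) = Du :=
  SignedMeasure.singularPart_add_withDensity_rnDeriv_eq (s := Du) (μ := volume)

/-- The weak form of the equation, tested with a continuously differentiable function. -/
theorem weak_form_contDiff {g u₀' : ℝ → ℝ} {s₀ s₁ u₀ u₁ κ₀ κ₁ : ℝ} {Du : SignedMeasure ℝ}
    (hu₀' : u₀' = acDensity Du)
    (h : ∀ (φ : ℝ → ℝ) (Dφ : SignedMeasure ℝ) (φ₀ φ₁ : ℝ),
      HasBVDeriv 0 1 φ Dφ → HasRightTrace φ 0 φ₀ → HasLeftTrace φ 1 φ₁ →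
      (singPart Dφ).totalVariation ≪ (singPart Du).totalVariation →
      (u₀ = κ₀ → φ₀ = 0) → (u₁ = κ₁ → φ₁ = 0) →
      (∫ x in Ioo 0 1, acDensity Du x * acDensity Dφ x / √(1 + acDensity Du x ^ 2))
        + (∫ᵛ x, singDirection Du x ∂•(singPart Dφ)) + s₀ * φ₀ + s₁ * φ₁
        = ∫ x in Ioo 0 1, g x * φ x)
    {φ : ℝ → ℝ} (hφ : ContDiff ℝ 1 φ) (h0 : u₀ = κ₀ → φ 0 = 0) (h1 : u₁ = κ₁ → φ 1 = 0) :
    (∫ x in Ioo 0 1, u₀' x / √(1 + u₀' x ^ 2) * deriv φ x) + s₀ * φ 0 + s₁ * φ 1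
      = ∫ x in Ioo 0 1, g x * φ x := by
  subst hu₀'
  have hi := hφ.integrable_indicator_deriv (a := 0) (b := 1)
  have key := h φ _ (φ 0) (φ 1) (hφ.hasBVDeriv zero_le_one) (hφ.continuous.hasRightTrace 0)
    (hφ.continuous.hasLeftTrace 1)
    (by rw [singPart_withDensityᵥ, SignedMeasure.totalVariation_zero]
        exact Measure.AbsolutelyContinuous.zero _) h0 h1
  rw [singPart_withDensityᵥ, VectorMeasure.integral_zero_vectorMeasure, add_zero] at key
  rw [← key]
  congr 2
  refine integral_congr_ae ?_
  filter_upwards [ae_restrict_of_ae (acDensity_withDensityᵥ hi), ae_restrict_mem measurableSet_Ioo]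
    with x hx hxm
  rw [hx, indicator_of_mem hxm]
  ring


/-! ### Primitives and weak derivatives. -/

section Primitive

variable {a b C : ℝ} {g H : ℝ → ℝ}

theorem absolutelyContinuousOnInterval_of_eq_primitive
    (hg : IntervalIntegrable g volume a b) (hH : ∀ x, H x = C - ∫ t in a..x, g t) :
    AbsolutelyContinuousOnInterval H a b := by
  have h := (LipschitzOnWith.absolutelyContinuousOnInterval (f := fun _ : ℝ => C) (a := a) (b := b)
    (K := 0) (LipschitzWith.const C).lipschitzOnWith).sub
      (hg.absolutelyContinuousOnInterval_intervalIntegral (c := a) left_mem_uIcc)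
  have e : H = (fun _ => C) - fun x => ∫ t in a..x, g t := funext hH
  rwa [e]

theorem ae_hasDerivAt_of_eq_primitive (hab : a ≤ b) (hg : IntervalIntegrable g volume a b)
    (hH : ∀ x, H x = C - ∫ t in a..x, g t) :
    ∀ᵐ x ∂(volume.restrict (Ioo a b)), HasDerivAt H (-g x) x := by
  have e : H = fun x => C - ∫ t in a..x, g t := funext hH
  rw [ae_restrict_iff' measurableSet_Ioo]
  filter_upwards [hg.ae_hasDerivAt_integral] with x hx hxm
  rw [uIcc_of_le hab] at hx
  rw [e]
  exact (hx (Ioo_subset_Icc_self hxm) a (left_mem_Icc.2 hab)).const_sub C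

theorem integral_primitive_mul_deriv (hab : a ≤ b) (hg : IntervalIntegrable g volume a b)
    (hH : ∀ x, H x = C - ∫ t in a..x, g t) {φ : ℝ → ℝ} (hφ : ContDiff ℝ 1 φ) :
    ∫ x in Ioo a b, H x * deriv φ x
      = H b * φ b - H a * φ a + ∫ x in Ioo a b, g x * φ x := by
  rw [(absolutelyContinuousOnInterval_of_eq_primitive hg hH).integral_Ioo_mul_deriv hab
    (ae_hasDerivAt_of_eq_primitive hab hg hH) hφ]
  simp only [neg_mul, integral_neg, sub_neg_eq_add]

/-- A function whose weak derivative is `-g` is almost everywhere a primitive of `-g`. -/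
theorem exists_ae_eq_primitive (hab : a < b) {p : ℝ → ℝ} (hp : IntegrableOn p (Ioo a b))
    (hg : IntervalIntegrable g volume a b)
    (h : ∀ φ, IsTestFunction a b φ →
      ∫ x in Ioo a b, p x * deriv φ x = ∫ x in Ioo a b, g x * φ x) :
    ∃ C, ∀ᵐ x ∂(volume.restrict (Ioo a b)), p x = C - ∫ t in a..x, g t := by
  set H : ℝ → ℝ := fun x => 0 - ∫ t in a..x, g t with hH
  have hHac := absolutelyContinuousOnInterval_of_eq_primitive hg (fun x => (rfl : H x = _))
  have hHi : IntegrableOn H (Ioo a b) := by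
    have h1 := hHac.continuousOn
    rw [uIcc_of_le hab.le] at h1
    exact (h1.integrableOn_compact isCompact_Icc).mono_set Ioo_subset_Icc_self
  obtain ⟨C, hC⟩ := ae_eq_const_of_integral_mul_deriv_eq_zero hab (v := fun x => p x - H x)
    (hp.sub hHi) fun φ hφ => by
      have hφ' : Continuous (deriv φ) := hφ.contDiff_one.continuous_deriv le_rfl
      obtain ⟨C, hC⟩ := hφ.2.1.deriv.exists_bound_of_continuous hφ'
      simp only [sub_mul]
      rw [integral_sub (hp.mul_bdd hφ'.aestronglyMeasurable (ae_of_all _ hC))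
        (hHi.mul_bdd hφ'.aestronglyMeasurable (ae_of_all _ hC)), h φ hφ,
        integral_primitive_mul_deriv hab.le hg (fun x => rfl) hφ.contDiff_one,
        hφ.eq_zero (fun h => lt_irrefl _ h.1), hφ.eq_zero (fun h => lt_irrefl _ h.2)]
      ring
  refine ⟨C, ?_⟩
  filter_upwards [hC] with x hx
  simp only [hH] at hx
  linarith

end Primitive

/-! ### Regularity from the strict flux bound. -/

/-- If the flux `H` is a primitive of `-g` bounded away from `±1`, the function with slope
`H / √(1 - H²)` is a regular solution. -/
theorem regularity_of_flux {g H u : ℝ → ℝ} {C κ₀ m : ℝ} (hg : Integrable g)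
    (hH : ∀ x, H x = C - ∫ t in (0 : ℝ)..x, g t) (hm : m < 1)
    (hHm : ∀ x ∈ Icc (0 : ℝ) 1, |H x| ≤ m)
    (hu : ∀ᵐ x ∂(volume.restrict (Ioo 0 1)),
      u x = κ₀ + ∫ t in (0 : ℝ)..x, H t / √(1 - H t ^ 2)) :
    MemW21 0 1 u ∧ ∃ U : ℝ → ℝ, (∀ᵐ x ∂(volume.restrict (Ioo 0 1)), U x = u x) ∧
      ContinuousOn U (Icc 0 1) ∧ DifferentiableOn ℝ U (Ioo 0 1) ∧
      (∀ᵐ x ∂(volume.restrict (Ioo 0 1)),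
        HasDerivAt (fun y => deriv U y / √(1 + deriv U y ^ 2)) (-g x) x) ∧
      U 0 = κ₀ ∧ U 1 = κ₀ + ∫ t in (0 : ℝ)..1, H t / √(1 - H t ^ 2) := by
  set G : ℝ → ℝ := fun s => s / √(1 - s ^ 2) with hG
  set G' : ℝ → ℝ := fun s => 1 / ((1 - s ^ 2) * √(1 - s ^ 2)) with hG'
  set A : ℝ → ℝ := fun x => G (H x) with hA
  have hHac := absolutelyContinuousOnInterval_of_eq_primitive
    (hg.intervalIntegrable (a := 0) (b := 1)) hH
  have hHd := ae_hasDerivAt_of_eq_primitive zero_le_one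
    (hg.intervalIntegrable (a := 0) (b := 1)) hH
  have hHc : Continuous H := by
    have : H = fun x => C - ∫ t in (0 : ℝ)..x, g t := funext hH
    rw [this]
    exact continuous_const.sub (intervalIntegral.continuous_primitive
      (fun _ _ => hg.intervalIntegrable) 0)
  have hmem : ∀ {s}, s ∈ Icc (-m) m → |s| < 1 := fun hs => (abs_le.2 hs).trans_lt hm
  have hm0 : 0 ≤ m := (abs_nonneg _).trans (hHm 0 (by simp))
  have hHmem : ∀ x ∈ Icc (0 : ℝ) 1, H x ∈ Icc (-m) m := fun x hx => abs_le.1 (hHm x hx)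
  have hpos : ∀ {s}, s ∈ Icc (-m) m → 0 < (1 - s ^ 2) * √(1 - s ^ 2) := by
    intro s hs
    have h0 : 0 < 1 - s ^ 2 := by nlinarith [abs_lt.1 (hmem hs)]
    exact mul_pos h0 (Real.sqrt_pos.2 h0)
  have hG'c : ContinuousOn G' (Icc (-m) m) :=
    ContinuousOn.div (by fun_prop) (by fun_prop) fun s hs => (hpos hs).ne'
  obtain ⟨K, hK⟩ := isCompact_Icc.exists_bound_of_continuousOn hG'c
  -- The bound `m < 1` enters here: `G'` is bounded on `[-m, m]`, so the slope `A = G ∘ H` inherits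
  -- absolute continuity from `H`.
  have hlip : LipschitzOnWith K.toNNReal G (Icc (-m) m) := by
    refine (convex_Icc _ _).lipschitzOnWith_of_nnnorm_hasDerivWithin_le (f' := G')
      (fun s hs => (hasDerivAt_div_sqrt_one_sub_sq (hmem hs)).hasDerivWithinAt) fun s hs => ?_
    rw [← NNReal.coe_le_coe, coe_nnnorm]
    exact (hK s hs).trans (Real.le_coe_toNNReal K)
  have hAac : AbsolutelyContinuousOnInterval A 0 1 :=
    hHac.lipschitzOnWith_comp hlip (by rw [uIcc_of_le zero_le_one]; exact hHmem)
  have hAc : ContinuousOn A (Icc 0 1) := by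
    have := hAac.continuousOn
    rwa [uIcc_of_le zero_le_one] at this
  have hAi : IntervalIntegrable A volume 0 1 := hAac.continuousOn.intervalIntegrable
  have hAm : Measurable A := by
    have : Measurable G := by fun_prop
    exact this.comp hHc.measurable
  set U : ℝ → ℝ := fun x => κ₀ + ∫ t in (0 : ℝ)..x, A t with hU
  have hUd : ∀ x ∈ Ioo (0 : ℝ) 1, HasDerivAt U (A x) x := by
    intro x hx
    refine (intervalIntegral.integral_hasDerivAt_right (hAi.mono_set ?_)
      hAm.stronglyMeasurable.stronglyMeasurableAtFilter ?_).const_add κ₀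
    · rw [uIcc_of_le hx.1.le, uIcc_of_le zero_le_one]
      exact Icc_subset_Icc_right hx.2.le
    · exact hAc.continuousAt (Icc_mem_nhds hx.1 hx.2)
  have hUac : AbsolutelyContinuousOnInterval U 0 1 := by
    refine absolutelyContinuousOnInterval_of_eq_primitive (C := κ₀) hAi.neg fun x => ?_
    simp [hU]
  have hUc : ContinuousOn U (Icc 0 1) := by
    have := hUac.continuousOn
    rwa [uIcc_of_le zero_le_one] at this
  have hUint : IntegrableOn U (Ioo 0 1) :=
    (hUc.integrableOn_compact isCompact_Icc).mono_set Ioo_subset_Icc_self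
  have hAint : IntegrableOn A (Ioo 0 1) :=
    (hAc.integrableOn_compact isCompact_Icc).mono_set Ioo_subset_Icc_self
  refine ⟨⟨A, fun x => G' (H x) * -g x, ⟨?_, hAint, fun φ hφ => ?_⟩, ⟨hAint, ?_, fun φ hφ => ?_⟩⟩,
    U, ?_, hUc, fun x hx => (hUd x hx).differentiableAt.differentiableWithinAt, ?_, by simp [hU],
    rfl⟩
  · exact hUint.congr (by filter_upwards [hu] with x hx using hx.symm)
  · have e : ∫ x in Ioo 0 1, u x * deriv φ x = ∫ x in Ioo 0 1, U x * deriv φ x := by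
      refine integral_congr_ae ?_
      filter_upwards [hu] with x hx
      rw [hx]
    rw [e, hUac.integral_Ioo_mul_deriv zero_le_one (w := A)
      ((ae_restrict_iff' measurableSet_Ioo).2 (ae_of_all _ hUd)) hφ.contDiff_one,
      hφ.eq_zero (fun h => lt_irrefl _ h.1), hφ.eq_zero (fun h => lt_irrefl _ h.2)]
    ring
  · refine Integrable.bdd_mul (c := K) hg.neg.integrableOn ?_ ?_
    · have : Measurable G' := by fun_prop
      exact (this.comp hHc.measurable).aestronglyMeasurable
    · filter_upwards [ae_restrict_mem measurableSet_Ioo] with x hx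
      exact hK _ (hHmem x (Ioo_subset_Icc_self hx))
  · rw [hAac.integral_Ioo_mul_deriv zero_le_one (w := fun x => G' (H x) * -g x) ?_ hφ.contDiff_one,
      hφ.eq_zero (fun h => lt_irrefl _ h.1), hφ.eq_zero (fun h => lt_irrefl _ h.2)]
    · ring
    · filter_upwards [hHd, ae_restrict_mem measurableSet_Ioo] with x hx hxm
      exact (hasDerivAt_div_sqrt_one_sub_sq
        (hmem (hHmem x (Ioo_subset_Icc_self hxm)))).comp x hx
  · filter_upwards [hu] with x hx using hx.symm
  · filter_upwards [hHd, ae_restrict_mem measurableSet_Ioo] with x hx hxm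
    -- In a neighbourhood of `x` the flux of `U` is exactly `H`, hence has the same derivative.
    refine hx.congr_of_eventuallyEq ?_
    filter_upwards [isOpen_Ioo.mem_nhds hxm] with y hy
    rw [(hUd y hy).deriv]
    exact div_sqrt_one_sub_sq_inverse (hmem (hHmem y (Ioo_subset_Icc_self hy)))

/-! ### Vanishing of the singular part. -/

/-- Testing the weak form with `u` minus the affine interpolation of the boundary data shows that
the derivative of `u` has no singular part when the flux is bounded away from `±1`. -/
theorem singPart_totalVariation_eq_zero {g H u : ℝ → ℝ} {C κ₀ κ₁ s₀ s₁ m : ℝ}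
    {Du : SignedMeasure ℝ} (hg : Integrable g)
    (hH : ∀ x, H x = C - ∫ t in (0 : ℝ)..x, g t) (hm : m < 1)
    (hHm : ∀ x ∈ Icc (0 : ℝ) 1, |H x| ≤ m)
    (hDu : HasBVDeriv 0 1 u Du) (hu₀ : HasRightTrace u 0 κ₀) (hu₁ : HasLeftTrace u 1 κ₁)
    (haH : ∀ᵐ x ∂(volume.restrict (Ioo 0 1)),
      acDensity Du x / √(1 + acDensity Du x ^ 2) = H x)
    (h : ∀ (φ : ℝ → ℝ) (Dφ : SignedMeasure ℝ) (φ₀ φ₁ : ℝ),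
      HasBVDeriv 0 1 φ Dφ → HasRightTrace φ 0 φ₀ → HasLeftTrace φ 1 φ₁ →
      (singPart Dφ).totalVariation ≪ (singPart Du).totalVariation →
      (κ₀ = κ₀ → φ₀ = 0) → (κ₁ = κ₁ → φ₁ = 0) →
      (∫ x in Ioo 0 1, acDensity Du x * acDensity Dφ x / √(1 + acDensity Du x ^ 2))
        + (∫ᵛ x, singDirection Du x ∂•(singPart Dφ)) + s₀ * φ₀ + s₁ * φ₁
        = ∫ x in Ioo 0 1, g x * φ x) :
    (singPart Du).totalVariation = 0 := by
  have hm0 : 0 ≤ m := (abs_nonneg _).trans (hHm 0 (by simp))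
  have hHc : Continuous H := by
    have : H = fun x => C - ∫ t in (0 : ℝ)..x, g t := funext hH
    rw [this]
    exact continuous_const.sub (intervalIntegral.continuous_primitive
      (fun _ _ => hg.intervalIntegrable) 0)
  have hsub : ∀ x y, H x - H y = ∫ t in x..y, g t := by
    intro x y
    have := intervalIntegral.integral_interval_sub_left (μ := volume) (f := g) (a := 0) (b := y)
      (c := x) hg.intervalIntegrable hg.intervalIntegrable
    rw [hH, hH, ← this]
    ring
  obtain ⟨hrep, htot⟩ := hDu.ae_eq_add_apply_Iio zero_lt_one hu₀ hu₁
  set ℓ : ℝ → ℝ := fun x => κ₀ + (κ₁ - κ₀) * x with hℓ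
  have hℓs : ContDiff ℝ 1 ℓ := by fun_prop
  have hℓd : Continuous (deriv ℓ) := hℓs.continuous_deriv le_rfl
  have hi := hℓs.integrable_indicator_deriv (a := 0) (b := 1)
  set a := acDensity Du with ha
  have hai : Integrable a := SignedMeasure.integrable_rnDeriv _ _
  have key := h (fun x => u x - ℓ x) _ (κ₀ - ℓ 0) (κ₁ - ℓ 1) (hDu.sub (hℓs.hasBVDeriv zero_le_one))
    (hu₀.sub (hℓs.continuous.hasRightTrace 0)) (hu₁.sub (hℓs.continuous.hasLeftTrace 1))
    (by rw [singPart_sub_withDensityᵥ]) (by simp [hℓ]) (by simp [hℓ])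
  rw [singPart_sub_withDensityᵥ] at key
  have z0 : κ₀ - ℓ 0 = 0 := by simp [hℓ]
  have z1 : κ₁ - ℓ 1 = 0 := by simp [hℓ]
  rw [z0, z1, mul_zero, mul_zero, add_zero, add_zero] at key
  -- `H` is bounded by `m` only on `[0, 1]`; truncation gives a global bound and changes nothing for
  -- `Du`, which lives on `(0, 1)`.
  set F : ℝ → ℝ := (Ioo (0 : ℝ) 1).indicator H with hF
  have hFm : Measurable F := hHc.measurable.indicator measurableSet_Ioo
  have hFb : ∀ x, ‖F x‖ ≤ m := by
    intro x
    by_cases hx : x ∈ Ioo (0 : ℝ) 1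
    · rw [hF, indicator_of_mem hx]
      exact hHm x (Ioo_subset_Icc_self hx)
    · rw [hF, indicator_of_notMem hx, norm_zero]
      exact hm0
  have hHb : ∀ᵐ x ∂(volume.restrict (Ioo (0 : ℝ) 1)), ‖H x‖ ≤ m := by
    filter_upwards [ae_restrict_mem measurableSet_Ioo] with x hx using
      hHm x (Ioo_subset_Icc_self hx)
  have hHa : IntegrableOn (fun x => H x * a x) (Ioo 0 1) :=
    Integrable.bdd_mul (c := m) hai.integrableOn hHc.aestronglyMeasurable hHb
  have hHℓ : IntegrableOn (fun x => H x * deriv ℓ x) (Ioo 0 1) :=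
    ((hHc.mul hℓd).integrableOn_Icc).mono_set Ioo_subset_Icc_self
  -- the absolutely continuous part of the left-hand side
  have e1 : ∫ x in Ioo 0 1, a x * acDensity (Du - volume.withDensityᵥ
      ((Ioo (0 : ℝ) 1).indicator (deriv ℓ))) x / √(1 + a x ^ 2)
      = (∫ x in Ioo 0 1, H x * a x) - ∫ x in Ioo 0 1, H x * deriv ℓ x := by
    rw [← integral_sub hHa hHℓ]
    refine integral_congr_ae ?_
    filter_upwards [haH, ae_restrict_of_ae (acDensity_sub_withDensityᵥ Du hi),
      ae_restrict_mem measurableSet_Ioo] with x hx1 hx2 hx3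
    rw [hx2, indicator_of_mem hx3, ← hx1]
    ring
  -- the right-hand side
  have hgu := SignedMeasure.integral_mul_apply_Iio Du
    (hg.integrableOn (s := Ioo (0 : ℝ) 1))
  -- By Fubini, with the tail integral of `g` from `t` to `1` equal to `H t - H 1`.
  have e2 : ∫ x in Ioo 0 1, g x * Du (Iio x) = (∫ᵛ x, F x ∂•Du) - H 1 * Du univ := by
    rw [hgu.1, hDu.integral_congr_Ioo (G := fun x => F x - H 1) fun t ht => ?_]
    · rw [VectorMeasure.integral_fun_sub (SignedMeasure.integrable_of_bound Du hFm hFb)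
        (SignedMeasure.integrable_of_bound Du (F := fun _ => H 1) measurable_const
          (C := ‖H 1‖) fun _ => le_rfl)]
      have : IsFiniteMeasure (VectorMeasure.variation Du) := by
        rw [← SignedMeasure.totalVariation_eq_variation]
        infer_instance
      rw [VectorMeasure.integral_const]
      simp
    · simp only [hF]
      rw [integral_Ioi_restrict_Ioo ht, indicator_of_mem ht, hsub]
  have e3 : ∫ x in Ioo 0 1, g x * (u x - ℓ x)
      = (∫ᵛ x, F x ∂•Du) - ∫ x in Ioo 0 1, H x * deriv ℓ x := by
    have hgℓ : IntegrableOn (fun x => g x * ℓ x) (Ioo 0 1) := by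
      obtain ⟨c, hc⟩ := isCompact_Icc.exists_bound_of_continuousOn
        (hℓs.continuous.continuousOn (s := Icc (0 : ℝ) 1))
      refine Integrable.mul_bdd (c := c) hg.integrableOn hℓs.continuous.aestronglyMeasurable ?_
      filter_upwards [ae_restrict_mem measurableSet_Ioo] with x hx using
        hc x (Ioo_subset_Icc_self hx)
    have hgI : IntegrableOn g (Ioo 0 1) := hg.integrableOn
    have s1 : ∫ x in Ioo 0 1, g x * (u x - ℓ x) = ∫ x in Ioo 0 1,
        (κ₀ * g x + g x * Du (Iio x) - g x * ℓ x) := by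
      refine integral_congr_ae ?_
      filter_upwards [hrep] with x hx
      rw [hx]
      ring
    have s2 : ∫ x in Ioo 0 1, g x = H 0 - H 1 := by
      rw [hsub, intervalIntegral.integral_of_le zero_le_one, integral_Ioc_eq_integral_Ioo]
    have s3 := integral_primitive_mul_deriv zero_le_one
      (hg.intervalIntegrable (a := 0) (b := 1)) hH hℓs
    have s4 : ℓ 0 = κ₀ := by linarith
    have s5 : ℓ 1 = κ₁ := by linarith
    rw [s4, s5] at s3
    rw [s1, integral_sub (Integrable.fun_add (hgI.const_mul κ₀) hgu.2) hgℓ,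
      integral_add (hgI.const_mul κ₀) hgu.2, integral_const_mul, e2, s2]
    have s6 : Du univ = κ₁ - κ₀ := by linarith
    rw [s6]
    linarith
  have e4 : ∫ᵛ x, F x ∂•Du = (∫ᵛ x, F x ∂•(singPart Du)) + ∫ x in Ioo 0 1, H x * a x := by
    have d : singPart Du + volume.withDensityᵥ a = Du :=
      singPart_add_withDensityᵥ_acDensity Du
    conv_lhs => rw [← d]
    rw [VectorMeasure.integral_add_vectorMeasure
      (SignedMeasure.integrable_of_bound _ hFm hFb) (SignedMeasure.integrable_of_bound _ hFm hFb),
      SignedMeasure.integral_lsmul_withDensityᵥ hai hFm hFb, ← integral_indicator measurableSet_Ioo]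
    congr 2
    ext x
    by_cases hx : x ∈ Ioo (0 : ℝ) 1 <;> simp [hF, hx]
  refine SignedMeasure.totalVariation_eq_zero_of_integral_rnDeriv_eq (singPart Du) hm
    (f := F) (ae_of_all _ hFb) ?_
  -- The terms in `H a` and `H ℓ'` occur on both sides and cancel, leaving only the singular part.
  have e5 : ∫ᵛ x, singDirection Du x ∂•(singPart Du) = ∫ᵛ x, F x ∂•(singPart Du) := by
    rw [e1, e3, e4] at key
    linarith
  exact e5

/-! ### The main theorem. -/

theorem theorem4p2 (f : ℝ → ℝ → ℝ) (κ₀ κ₁ : ℝ) (u : ℝ → ℝ)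
    (hu : IsBVSolutionDirichlet f κ₀ κ₁ u)
    (z : ℝ) (hz : z ∈ Ioo (0 : ℝ) 1)
    (hpos : ∀ᵐ x ∂(volume.restrict (Ioo 0 z)), 0 ≤ f x (u x))
    (hneg : ∀ᵐ x ∂(volume.restrict (Ioo z 1)), f x (u x) ≤ 0)
    (h0 : ∃ δ : ℝ, 0 < δ ∧ δ ≤ 1 ∧ ∃ μ₀ : ℝ → ℝ, IntegrableOn μ₀ (Ioo 0 δ) ∧
      (∀ᵐ x ∂(volume.restrict (Ioo 0 δ)), f x (u x) ≤ μ₀ x) ∧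
      (∀ x ∈ Ioc 0 δ, 0 < ∫ t in (0 : ℝ)..x, μ₀ t) ∧
      ∫⁻ x in Ioo 0 δ, ENNReal.ofReal (1 / √(∫ t in (0 : ℝ)..x, μ₀ t)) = ⊤)
    (h1 : ∃ δ : ℝ, 0 < δ ∧ δ ≤ 1 ∧ ∃ ν₁ : ℝ → ℝ, IntegrableOn ν₁ (Ioo (1 - δ) 1) ∧
      (∀ᵐ x ∂(volume.restrict (Ioo (1 - δ) 1)), ν₁ x ≤ f x (u x)) ∧
      (∀ x ∈ Ico (1 - δ) 1, ∫ t in x..1, ν₁ t < 0) ∧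
      ∫⁻ x in Ioo (1 - δ) 1, ENNReal.ofReal (1 / √(-∫ t in x..1, ν₁ t)) = ⊤)
    (hcz : (∃ δ : ℝ, 0 < δ ∧ δ ≤ z ∧ ∃ μz : ℝ → ℝ, IntegrableOn μz (Ioo (z - δ) z) ∧
        (∀ᵐ x ∂(volume.restrict (Ioo (z - δ) z)), f x (u x) ≤ μz x) ∧
        (∀ x ∈ Ico (z - δ) z, 0 < ∫ t in x..z, μz t) ∧
        ∫⁻ x in Ioo (z - δ) z, ENNReal.ofReal (1 / √(∫ t in x..z, μz t)) = ⊤) ∨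
      (∃ δ : ℝ, 0 < δ ∧ δ ≤ 1 - z ∧ ∃ νz : ℝ → ℝ, IntegrableOn νz (Ioo z (z + δ)) ∧
        (∀ᵐ x ∂(volume.restrict (Ioo z (z + δ))), νz x ≤ f x (u x)) ∧
        (∀ x ∈ Ioc z (z + δ), ∫ t in z..x, νz t < 0) ∧
        ∫⁻ x in Ioo z (z + δ), ENNReal.ofReal (1 / √(-∫ t in z..x, νz t)) = ⊤)) :
    MemW21 0 1 u ∧ SolvesDirichletAE f κ₀ κ₁ u := by
  obtain ⟨hfu, Du, u₀, u₁, hDu, hu₀, hu₁, hweak⟩ := hu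
  -- Extension by zero makes `g` integrable on `ℝ`, so its primitive is defined and continuous
  -- everywhere.
  set g : ℝ → ℝ := (Ioo (0 : ℝ) 1).indicator fun x => f x (u x) with hg_def
  have hg : Integrable g := (integrable_indicator_iff measurableSet_Ioo).2 hfu
  have hgf : ∀ x ∈ Ioo (0 : ℝ) 1, g x = f x (u x) := fun x hx => indicator_of_mem hx _
  have hgf' : ∀ p q, 0 ≤ p → q ≤ 1 → ∀ᵐ x ∂(volume.restrict (Ioo p q)), g x = f x (u x) := by
    intro p q hp hq
    filter_upwards [ae_restrict_mem measurableSet_Ioo] with x hx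
    exact hgf x ⟨hp.trans_lt hx.1, hx.2.trans_le hq⟩
  have hweak' : ∀ (φ : ℝ → ℝ) (Dφ : SignedMeasure ℝ) (φ₀ φ₁ : ℝ),
      HasBVDeriv 0 1 φ Dφ → HasRightTrace φ 0 φ₀ → HasLeftTrace φ 1 φ₁ →
      (singPart Dφ).totalVariation ≪ (singPart Du).totalVariation →
      (u₀ = κ₀ → φ₀ = 0) → (u₁ = κ₁ → φ₁ = 0) →
      (∫ x in Ioo 0 1, acDensity Du x * acDensity Dφ x / √(1 + acDensity Du x ^ 2))
        + (∫ᵛ x, singDirection Du x ∂•(singPart Dφ))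
        + Real.sign (u₀ - κ₀) * φ₀ + Real.sign (u₁ - κ₁) * φ₁
        = ∫ x in Ioo 0 1, g x * φ x := by
    intro φ Dφ φ₀ φ₁ i1 i2 i3 i4 i5 i6
    rw [hweak φ Dφ φ₀ φ₁ i1 i2 i3 i4 i5 i6]
    exact setIntegral_congr_fun measurableSet_Ioo fun x hx => by simp only [hgf x hx]
  have hsmooth := fun {φ : ℝ → ℝ} => weak_form_contDiff (φ := φ) rfl hweak'
  set a := acDensity Du with ha
  have hai : Integrable a := SignedMeasure.integrable_rnDeriv _ _
  have ham : Measurable a := SignedMeasure.measurable_rnDeriv _ _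
  have hpi : IntegrableOn (fun x => a x / √(1 + a x ^ 2)) (Ioo 0 1) := by
    have hm : Measurable fun x => a x / √(1 + a x ^ 2) := by fun_prop
    exact Integrable.of_bound hm.aestronglyMeasurable 1
      (ae_of_all _ fun x => (div_sqrt_one_add_sq_bound (a x)).1.le)
  obtain ⟨C, haH⟩ := exists_ae_eq_primitive zero_lt_one hpi hg.intervalIntegrable fun φ hφ => by
    have e0 := hφ.eq_zero (x := 0) fun h => lt_irrefl _ h.1
    have e1 := hφ.eq_zero (x := 1) fun h => lt_irrefl _ h.2
    have := hsmooth hφ.contDiff_one (fun _ => e0) (fun _ => e1)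
    simpa [e0, e1] using this
  set H : ℝ → ℝ := fun x => C - ∫ t in (0 : ℝ)..x, g t with hH_def
  have hH : ∀ x, H x = C - ∫ t in (0 : ℝ)..x, g t := fun x => rfl
  obtain ⟨m, hm, hHm⟩ : ∃ m < 1, ∀ x ∈ Icc (0 : ℝ) 1, |H x| ≤ m := by
    refine flux_abs_lt_one hz hg hH hai.integrableOn haH ?_ ?_ ?_ ?_ ?_
    · filter_upwards [hpos, hgf' 0 z le_rfl hz.2.le] with x h1 h2
      rwa [h2]
    · filter_upwards [hneg, hgf' z 1 hz.1.le le_rfl] with x h1 h2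
      rwa [h2]
    · obtain ⟨δ, hδ, hδ1, μ, hμ, hle, hrest⟩ := h0
      refine ⟨δ, hδ, hδ1, μ, hμ, ?_, hrest⟩
      filter_upwards [hle, hgf' 0 δ le_rfl hδ1] with x h1 h2
      rwa [h2]
    · obtain ⟨δ, hδ, hδ1, μ, hμ, hle, hrest⟩ := h1
      refine ⟨δ, hδ, hδ1, μ, hμ, ?_, hrest⟩
      filter_upwards [hle, hgf' (1 - δ) 1 (by linarith) le_rfl] with x h1 h2
      rwa [h2]
    · rcases hcz with ⟨δ, hδ, hδ1, μ, hμ, hle, hrest⟩ | ⟨δ, hδ, hδ1, μ, hμ, hle, hrest⟩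
      · refine Or.inl ⟨δ, hδ, hδ1, μ, hμ, ?_, hrest⟩
        filter_upwards [hle, hgf' (z - δ) z (by linarith) hz.2.le] with x h1 h2
        rwa [h2]
      · refine Or.inr ⟨δ, hδ, hδ1, μ, hμ, ?_, hrest⟩
        filter_upwards [hle, hgf' z (z + δ) hz.1.le (by linarith)] with x h1 h2
        rwa [h2]
  have habs_sign : ∀ r : ℝ, r ≠ 0 → |Real.sign r| = 1 := by
    intro r hr
    rcases Real.sign_apply_eq_of_ne_zero r hr with h | h <;> simp [h]
  have hparts := fun {φ : ℝ → ℝ} => integral_primitive_mul_deriv (φ := φ) zero_le_one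
    (hg.intervalIntegrable (a := 0) (b := 1)) hH
  have hHp : ∀ φ : ℝ → ℝ, ∫ x in Ioo 0 1, a x / √(1 + a x ^ 2) * deriv φ x
      = ∫ x in Ioo 0 1, H x * deriv φ x := by
    intro φ
    refine integral_congr_ae ?_
    filter_upwards [haH] with x hx
    rw [hx]
  have hb0 : u₀ = κ₀ := by
    by_contra hne
    -- This test function vanishes at `1` and isolates the boundary term at `0`: it gives `H 0 =
    -- ±1`, against `|H| ≤ m < 1`.
    have hφ : ContDiff ℝ 1 fun x : ℝ => 1 - x := by fun_prop
    have e1 := hsmooth hφ (fun h => absurd h hne) (fun _ => by simp)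
    rw [hHp, hparts hφ] at e1
    have e2 : H 0 = Real.sign (u₀ - κ₀) := by
      simp only [sub_self, sub_zero, mul_zero, mul_one] at e1
      linarith
    have e3 := hHm 0 (by simp)
    rw [e2, habs_sign _ (sub_ne_zero.2 hne)] at e3
    linarith
  have hb1 : u₁ = κ₁ := by
    by_contra hne
    have hφ : ContDiff ℝ 1 fun x : ℝ => x := by fun_prop
    have e1 := hsmooth hφ (fun _ => by simp) (fun h => absurd h hne)
    rw [hHp, hparts hφ] at e1
    have e2 : H 1 = -Real.sign (u₁ - κ₁) := by
      simp only [mul_zero, mul_one] at e1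
      linarith
    have e3 := hHm 1 (by simp)
    rw [e2, abs_neg, habs_sign _ (sub_ne_zero.2 hne)] at e3
    linarith
  subst hb0 hb1
  have hsing := singPart_totalVariation_eq_zero hg hH hm hHm hDu hu₀ hu₁ haH hweak'
  obtain ⟨hrep, htot⟩ := hDu.ae_eq_add_apply_Iio zero_lt_one hu₀ hu₁
  have hDua : Du = volume.withDensityᵥ a := by
    have hs : singPart Du = 0 := by
      ext i hi
      exact SignedMeasure.apply_eq_zero_of_subset (B := univ) (by rw [hsing]; rfl) (subset_univ i)
    have d : singPart Du + volume.withDensityᵥ a = Du :=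
      singPart_add_withDensityᵥ_acDensity Du
    rw [← d, hs, zero_add]
  have hslope : ∀ᵐ x ∂(volume.restrict (Ioo 0 1)), a x = H x / √(1 - H x ^ 2) := by
    filter_upwards [haH] with x hx
    have := (div_sqrt_one_add_sq_bound (a x)).2
    rw [hx] at this
    exact this
  have hDuI : ∀ B : Set ℝ, MeasurableSet B → Du B = ∫ x in B ∩ Ioo 0 1, a x := by
    intro B hB
    have h1 := Du.of_union (A := B ∩ Ioo 0 1) (B := B \ Ioo 0 1) disjoint_sdiff_inter.symm
      (hB.inter measurableSet_Ioo) (hB.diff measurableSet_Ioo)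
    rw [inter_union_sdiff, SignedMeasure.apply_eq_zero_of_subset hDu.concentrated
      (fun x hx => hx.2 : B \ Ioo 0 1 ⊆ (Ioo (0 : ℝ) 1)ᶜ), add_zero] at h1
    rw [h1, hDua, withDensityᵥ_apply hai (hB.inter measurableSet_Ioo)]
  have hprim : ∀ x ∈ Icc (0 : ℝ) 1, ∫ t in Ioo 0 x, a t = ∫ t in (0 : ℝ)..x, H t / √(1 - H t ^ 2) := by
    intro x hx
    rw [intervalIntegral.integral_of_le hx.1, integral_Ioc_eq_integral_Ioo]
    exact integral_congr_ae
      (ae_restrict_of_ae_restrict_of_subset (Ioo_subset_Ioo le_rfl hx.2) hslope)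
  obtain ⟨hW, U, hUu, hUc, hUd, hUe, hU0, hU1⟩ := regularity_of_flux (u := u) (κ₀ := u₀)
    hg hH hm hHm (by
      filter_upwards [hrep, ae_restrict_mem measurableSet_Ioo] with x hx hxm
      rw [hx, hDuI _ measurableSet_Iio, ← hprim x (Ioo_subset_Icc_self hxm)]
      congr 3
      ext t
      simp only [mem_inter_iff, mem_Iio, mem_Ioo]
      exact ⟨fun h => ⟨h.2.1, h.1⟩, fun h => ⟨h.2, h.1, h.2.trans hxm.2⟩⟩)
  refine ⟨hW, U, hUu, hUc, hUd, ?_, hU0, ?_⟩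
  · filter_upwards [hUe, hUu, hgf' 0 1 le_rfl le_rfl] with x h1 h2 h3
    rwa [h2, ← h3]
  -- The trace at `1` is the trace at `0` plus the total mass of `Du`, which is now the integral of
  -- the slope.
  · rw [hU1, htot, hDuI _ MeasurableSet.univ, univ_inter, hprim 1 (by simp)]
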